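/- Let $\mathbf K$ be a (strict) $2$-category. Write $\mathbf K[Y,X]$ for its hom-categories, $\circ$ for composition, $F\varphi$ and $\varphi_F$ for the two whiskerings of a $2$-morphism $\varphi$ with a $1$-morphism $F$. **Inserters and equifiers.** For $F,G\colon X\to X'$, let $\mathrm{Insert}[Y;F,G]$ be the category of pairs $(H\colon Y\to X,\ \tau\colon F\circ H\Rightarrow G\circ H)$, with morphisms $\varphi\colon H\Rightarrow H'$ such that $\tau'\cdot F\varphi=G\varphi\cdot\tau$. An inserter of $F$ and $G$ is a triple $(I,\ V\colon I\to X,\ \hat\theta\colon F\circ V\Rightarrow G\circ V)$ such that for every $Y$ the functor $\mathbf K[Y,I]\to\mathrm{Insert}[Y;F,G]$, $H\mapsto(V\circ H,\hat\theta_H)$, $\psi\mapsto V\psi$, is an isomorphism of categories. For $\varphi,\psi\colon F\Rightarrow G\colon X\to X'$, let $\mathrm{Equif}[Y;\varphi,\psi]$ be the full subcategory of $\mathbf K[Y,X]$ on those $H$ with $\varphi_H=\psi_H$. An equifier of $\varphi$ and $\psi$ is a $1$-morphism $W\colon E\to X$ with $\varphi_W=\psi_W$ such that for every $Y$ the functor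 $W\circ-\colon\mathbf K[Y,E]\to\mathrm{Equif}[Y;\varphi,\psi]$ is an isomorphism of categories. **Tangentads.** A tangentad $(X,\mathbb T)$ of $\mathbf K$ is an object $X$ with a $1$-morphism $T\colon X\to X$, $2$-morphisms $p\colon T\Rightarrow\mathrm{id}_X$, $z\colon\mathrm{id}_X\Rightarrow T$, $s\colon T_2\Rightarrow T$, $l\colon T\Rightarrow T^2$, $c\colon T^2\Rightarrow T^2$, where $T_n$ ($n\ge 0$) is an $n$-fold pullback of $p$ along itself that is pointwise (preserved by precomposition with every $1$-morphism) and preserved by all iterates $T^m$, such that: $\mathbf p=(p,z,s)$ is an additive bundle (a commutative monoid over $\mathrm{id}_X$); $(z,l)\colon\mathbf p\to T\mathbf p$ and $(\mathrm{id},c)\colon T\mathbf p\to\mathbf p_T$ are additive bundle morphisms; $Tl\cdot l=l_T\cdot l$, $c\cdot l=l$, $c^2=\mathrm{id}$, $Tc\cdot c_T\cdot Tc=c_T\cdot Tc\cdot c_T$, $c_T\cdot Tc\cdot l_T=Tl\cdot c$; and the vertical lift is universal: the square with top $Ts\cdot(z_T\times l)\colon T_2\Rightarrow T^2$, left side the projection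 $T_2\Rightarrow\mathrm{id}_X$, right side $Tp$ and bottom $z\colon\mathrm{id}_X\Rightarrow T$ is a pointwise pullback. **The $2$-category $\mathrm{Tng}(\mathbf K)$.** Its objects are the tangentads. A $1$-morphism $(X,\mathbb T)\to(X',\mathbb T')$ is a lax tangent $1$-morphism: $F\colon X\to X'$ with $\alpha\colon F\circ T\Rightarrow T'\circ F$ such that $(\mathrm{id}_F,\alpha)\colon F\mathbf p\to\mathbf p'_F$ is compatible with projections, zeros and sums, and $\alpha$ is compatible with the lifts and flips: $T'\alpha\cdot\alpha_T\cdot Fl=l'_F\cdot\alpha$ and $T'\alpha\cdot\alpha_T\cdot Fc=c'_F\cdot T'\alpha\cdot\alpha_T$. It is strict if $\alpha$ is an identity. A $2$-morphism $(F,\alpha)\Rightarrow(G,\beta)$ is a $\varphi\colon F\Rightarrow G$ with $T'\varphi\cdot\alpha=\beta\cdot\varphi_T$. For a tangentad $(X,\mathbb T)$, $(T,c)$ is a $1$-endomorphism of $(X,\mathbb T)$ and $p\colon(T,c)\Rightarrow\mathrm{id}$, $c\colon(T,c)^2\Rightarrow(T,c)^2$ are $2$-morphisms of $\mathrm{Tng}(\mathbf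 K)$; put $\bar T=(T,c)\circ-$. **Vector fields.** For tangentads $(X',\mathbb T')$ and $(X,\mathbb T)$, let $\mathrm{VF}[X',\mathbb T'\,|\,X,\mathbb T]$ be the category of pairs $(G,u)$ of a lax tangent $1$-morphism $G\colon(X',\mathbb T')\to(X,\mathbb T)$ and a tangent $2$-morphism $u\colon G\Rightarrow\bar TG$ with $p_G\cdot u=\mathrm{id}_G$; morphisms $(G,u)\to(G',u')$ are tangent $2$-morphisms $\varphi\colon G\Rightarrow G'$ with $\bar T\varphi\cdot u=u'\cdot\varphi$. It carries the tangent bundle functor $T^{\mathrm{VF}}(G,u)=(\bar TG,\ c_G\cdot\bar Tu)$. A tangentad $(E,\mathbb T^E)$ with a vector field $(U,v)$ in $\mathrm{VF}[E,\mathbb T^E\,|\,X,\mathbb T]$, where $U$ has distributive law $\beta$, induces for every tangentad $(X',\mathbb T')$ the functor $$\Gamma_v\colon\mathrm{Tng}(\mathbf K)[(X',\mathbb T'),(E,\mathbb T^E)]\to\mathrm{VF}[X',\mathbb T'\,|\,X,\mathbb T],\qquad H\mapsto(U\circ H,v_H),\quad\varphi\mapsto U\varphi,$$ with distributive law $\Gamma_v\circ\bar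 T^E\Rightarrow T^{\mathrm{VF}}\circ\Gamma_v$ given at $H$ by $\beta_H$. The tangentad $(X,\mathbb T)$ *admits the construction of vector fields*, with tangentad of vector fields $\mathrm{VF}(X,\mathbb T)=(E,\mathbb T^E)$ and universal vector field $v\colon U\Rightarrow\bar TU$, if $U$ is strict and, for every tangentad $(X',\mathbb T')$, $\Gamma_v$ is an isomorphism of categories with invertible distributive law. **Theorem.** Let $(X,\mathbb T)$ be a tangentad in $\mathbf K$. Let $(I,V,\hat\theta)$ be an inserter in $\mathbf K$ of $\mathrm{id}_X$ and $T$, so that $\hat\theta\colon V\Rightarrow T\circ V$, and let $W\colon E\to I$ be an equifier in $\mathbf K$ of $p_V\cdot\hat\theta$ and $\mathrm{id}_V\colon V\Rightarrow V$. Then $(X,\mathbb T)$ admits the construction of vector fields, and $\mathrm{VF}(X,\mathbb T)$ is that equifier. Precisely, there are tangent structures $\mathbb T^I$ on $I$ and $\mathbb T^E$ on $E$ for which $V$ and $W$ underlie strict tangent $1$-morphisms $V\colon (I,\mathbb T^I)\to(X,\mathbb T)$ and $W\colon(E,\mathbb T^E)\to(I,\mathbb T^I)$, $\hat\theta\colon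 V\Rightarrow (T,c)\circ V$ is a tangent $2$-morphism, and 1. $((I,\mathbb T^I),V,\hat\theta)$ is an inserter in $\mathrm{Tng}(\mathbf K)$ of $\mathrm{id}_{(X,\mathbb T)}$ and $(T,c)$; 2. $((E,\mathbb T^E),W)$ is an equifier in $\mathrm{Tng}(\mathbf K)$ of $p_V\cdot\hat\theta$ and $\mathrm{id}_V$; 3. $(E,\mathbb T^E)$ is the tangentad of vector fields of $(X,\mathbb T)$, with $U=V\circ W$ and universal vector field $v=\hat\theta_W$. In particular, if every parallel pair of $1$-morphisms of $\mathbf K$ has an inserter and every parallel pair of $2$-morphisms of $\mathbf K$ has an equifier, then $\mathbf K$ admits the construction of vector fields, i.e. every tangentad in $\mathbf K$ does. -/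

import Mathlib

open CategoryTheory Bicategory Limits

universe w v u v₁ v₂ u₁ u₂

namespace Tng

/-! ### Isomorphisms of categories, inserters and equifiers -/

/-- A functor is an isomorphism of categories if it has a strict inverse. -/
def IsIsoOfCategories {C : Type u₁} [Category.{v₁} C] {D : Type u₂} [Category.{v₂} D]
    (F : C ⥤ D) : Prop :=
  ∃ G : D ⥤ C, F ⋙ G = 𝟭 C ∧ G ⋙ F = 𝟭 D

section TwoLimits

variable {K : Type u} [Bicategory.{w, v} K]

/-- Objects of the category `Insert[Y; F, G]`: a 1-morphism `H : Y ⟶ X` with a 2-morphism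
`F ∘ H ⇒ G ∘ H`. (Composition is written in diagrammatic order, so `F ∘ H` is `H ≫ F`.) -/
structure Insert {X X' : K} (F G : X ⟶ X') (Y : K) where
  hom : Y ⟶ X
  cell : hom ≫ F ⟶ hom ≫ G

/-- Morphisms of `Insert[Y; F, G]`. -/
@[ext]
structure Insert.Hom {X X' : K} {F G : X ⟶ X'} {Y : K} (H H' : Insert F G Y) where
  cell : H.hom ⟶ H'.hom
  comm : cell ▷ F ≫ H'.cell = H.cell ≫ cell ▷ G

instance Insert.category {X X' : K} (F G : X ⟶ X') (Y : K) : Category (Insert F G Y) where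
  Hom H H' := Insert.Hom H H'
  id H := ⟨𝟙 _, by simp⟩
  comp φ ψ := ⟨φ.cell ≫ ψ.cell, by
    rw [comp_whiskerRight, Category.assoc, ψ.comm, ← Category.assoc, φ.comm, Category.assoc,
      ← comp_whiskerRight]⟩
  id_comp φ := Insert.Hom.ext (Category.id_comp φ.cell)
  comp_id φ := Insert.Hom.ext (Category.comp_id φ.cell)
  assoc φ ψ χ := Insert.Hom.ext (Category.assoc φ.cell ψ.cell χ.cell)

/-- The functor `K[Y, I] ⥤ Insert[Y; F, G]` induced by `V : I ⟶ X` and `θ : F ∘ V ⇒ G ∘ V`: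
it sends `H` to `(V ∘ H, θ_H)` and `ψ` to `V ψ`. -/
def insertFunctor {X X' : K} {F G : X ⟶ X'} {I : K} {V : I ⟶ X} (θ : V ≫ F ⟶ V ≫ G) (Y : K) :
    (Y ⟶ I) ⥤ Insert F G Y where
  obj H := ⟨H ≫ V, (α_ H V F).hom ≫ H ◁ θ ≫ (α_ H V G).inv⟩
  map {H H'} ψ := ⟨ψ ▷ V, by
    have h := whisker_exchange ψ θ
    rw [associator_naturality_left_assoc, ← reassoc_of% h]
    simp⟩
  map_id H := Insert.Hom.ext (id_whiskerRight H V)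
  map_comp φ ψ := Insert.Hom.ext (comp_whiskerRight φ ψ V)

/-- `(I, V, θ)` is an inserter of the parallel 1-morphisms `F` and `G`. -/
def IsInserter {X X' : K} (F G : X ⟶ X') {I : K} (V : I ⟶ X) (θ : V ≫ F ⟶ V ≫ G) : Prop :=
  ∀ Y : K, IsIsoOfCategories (insertFunctor θ Y)

/-- The category `Equif[Y; φ, ψ]`: the full subcategory of `K[Y, X]` of those `H` for which
`φ_H = ψ_H`. -/
abbrev Equif {X X' : K} {F G : X ⟶ X'} (φ ψ : F ⟶ G) (Y : K) :=
  ObjectProperty.FullSubcategory (fun H : Y ⟶ X => H ◁ φ = H ◁ ψ)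

/-- The functor `K[Y, E] ⥤ Equif[Y; φ, ψ]` of postcomposition with `W : E ⟶ X`, where
`φ_W = ψ_W`. -/
def equifFunctor {X X' : K} {F G : X ⟶ X'} {φ ψ : F ⟶ G} {E : K} {W : E ⟶ X}
    (h : W ◁ φ = W ◁ ψ) (Y : K) : (Y ⟶ E) ⥤ Equif φ ψ Y :=
  ObjectProperty.lift _ (postcomp Y W) (fun H => by
    change (H ≫ W) ◁ φ = (H ≫ W) ◁ ψ
    rw [comp_whiskerLeft, comp_whiskerLeft, h])

/-- `(E, W)` is an equifier of the parallel 2-morphisms `φ` and `ψ`. -/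
def IsEquifier {X X' : K} {F G : X ⟶ X'} (φ ψ : F ⟶ G) {E : K} (W : E ⟶ X) : Prop :=
  ∃ h : W ◁ φ = W ◁ ψ, ∀ Y : K, IsIsoOfCategories (equifFunctor h Y)

variable (K) in
/-- Every parallel pair of 1-morphisms of `K` has an inserter. -/
def HasInserters : Prop :=
  ∀ (X X' : K) (F G : X ⟶ X'), ∃ (I : K) (V : I ⟶ X) (θ : V ≫ F ⟶ V ≫ G), IsInserter F G V θ

variable (K) in
/-- Every parallel pair of 2-morphisms of `K` has an equifier. -/
def HasEquifiers : Prop :=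
  ∀ (X X' : K) (F G : X ⟶ X') (φ ψ : F ⟶ G), ∃ (E : K) (W : E ⟶ X), IsEquifier φ ψ W

end TwoLimits

/-! ### Additive bundles -/

/-- The data of an additive bundle in a category: a projection `q`, candidates `nfold n` (with maps
`π n i` to the total object and `nbase n` to the base) for the `n`-fold pullbacks of `q` along
itself, a zero morphism and a sum morphism. -/
structure Bundle (C : Type u₁) [Category.{v₁} C] where
  base : C
  total : C
  q : total ⟶ base
  nfold : ℕ → C
  nbase : ∀ n, nfold n ⟶ base
  π : ∀ n, Fin n → (nfold n ⟶ total)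
  π_q : ∀ n i, π n i ≫ q = nbase n
  zero : base ⟶ total
  sum : nfold 2 ⟶ total

namespace Bundle

variable {C : Type u₁} [Category.{v₁} C] {D : Type u₂} [Category.{v₂} D]

/-- `nfold n` with its projections is the `n`-fold pullback of `q` along itself. -/
def IsNFoldPullback (b : Bundle C) (n : ℕ) : Prop :=
  Nonempty (IsLimit (WidePullbackCone.mk (f := fun _ : Fin n => b.q) (b.nbase n) (b.π n)
    (b.π_q n)))

/-- The morphism `⟨x, y⟩ : Z ⟶ E₂` induced by the universal property of the 2-fold pullback. -/
noncomputable def pair {b : Bundle C} (hb : b.IsNFoldPullback 2) {Z : C} (x y : Z ⟶ b.total)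
    (h : x ≫ b.q = y ≫ b.q) : Z ⟶ b.nfold 2 :=
  hb.some.lift (WidePullbackCone.mk (x ≫ b.q) ![x, y]
    (fun i => by fin_cases i <;> simp [h]))

lemma pair_fst {b : Bundle C} (hb : b.IsNFoldPullback 2) {Z : C} (x y : Z ⟶ b.total)
    (h : x ≫ b.q = y ≫ b.q) : pair hb x y h ≫ b.π 2 0 = x :=
  hb.some.fac _ (some 0)

lemma pair_snd {b : Bundle C} (hb : b.IsNFoldPullback 2) {Z : C} (x y : Z ⟶ b.total)
    (h : x ≫ b.q = y ≫ b.q) : pair hb x y h ≫ b.π 2 1 = y :=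
  hb.some.fac _ (some 1)

lemma pair_q {b : Bundle C} (hb : b.IsNFoldPullback 2) {Z : C} (x y : Z ⟶ b.total)
    (h : x ≫ b.q = y ≫ b.q) : pair hb x y h ≫ b.nbase 2 = x ≫ b.q :=
  hb.some.fac _ none

/-- The sum `x + y` of two morphisms `x y : Z ⟶ E` with the same projection to the base. -/
noncomputable def add {b : Bundle C} (hb : b.IsNFoldPullback 2) {Z : C} (x y : Z ⟶ b.total)
    (h : x ≫ b.q = y ≫ b.q) : Z ⟶ b.total :=
  pair hb x y h ≫ b.sum

lemma add_q {b : Bundle C} (hb : b.IsNFoldPullback 2) (hs : b.sum ≫ b.q = b.nbase 2) {Z : C}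
    (x y : Z ⟶ b.total) (h : x ≫ b.q = y ≫ b.q) : add hb x y h ≫ b.q = x ≫ b.q := by
  rw [add, Category.assoc, hs, pair_q]

/-- The axioms of an additive bundle. -/
structure IsAdditive (b : Bundle C) : Prop where
  isNFoldPullback : ∀ n, b.IsNFoldPullback n
  zero_q : b.zero ≫ b.q = 𝟙 b.base
  sum_q : b.sum ≫ b.q = b.nbase 2
  add_assoc :
    add (isNFoldPullback 2)
        (add (isNFoldPullback 2) (b.π 3 0) (b.π 3 1) (by rw [b.π_q, b.π_q])) (b.π 3 2)
        (by rw [add_q _ sum_q, b.π_q, b.π_q]) =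
      add (isNFoldPullback 2) (b.π 3 0)
        (add (isNFoldPullback 2) (b.π 3 1) (b.π 3 2) (by rw [b.π_q, b.π_q]))
        (by rw [add_q _ sum_q, b.π_q, b.π_q])
  zero_add :
    add (isNFoldPullback 2) (b.q ≫ b.zero) (𝟙 b.total)
      (by rw [Category.assoc, zero_q, Category.comp_id, Category.id_comp]) = 𝟙 b.total
  add_comm :
    add (isNFoldPullback 2) (b.π 2 1) (b.π 2 0) (by rw [b.π_q, b.π_q]) = b.sum

/-- The image of the data of an additive bundle under a functor. -/
@[simps]
def map (b : Bundle C) (F : C ⥤ D) : Bundle D where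
  base := F.obj b.base
  total := F.obj b.total
  q := F.map b.q
  nfold n := F.obj (b.nfold n)
  nbase n := F.map (b.nbase n)
  π n i := F.map (b.π n i)
  π_q n i := by rw [← F.map_comp, b.π_q]
  zero := F.map b.zero
  sum := F.map b.sum

/-- `(f, g) : b ⟶ b'` is compatible with projections, zeros and sums. In the last condition, `g₂`
is the morphism `g ×_f g` induced on 2-fold pullbacks (unique as soon as `b'.nfold 2` is a
pullback). -/
structure IsHom (b b' : Bundle C) (f : b.base ⟶ b'.base) (g : b.total ⟶ b'.total) : Prop where
  comp_q : g ≫ b'.q = b.q ≫ f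
  zero_comp : b.zero ≫ g = f ≫ b'.zero
  sum_comp : ∃ g₂ : b.nfold 2 ⟶ b'.nfold 2,
    (∀ i, g₂ ≫ b'.π 2 i = b.π 2 i ≫ g) ∧ b.sum ≫ g = g₂ ≫ b'.sum

lemma IsHom.comp {b b' b'' : Bundle C} {f : b.base ⟶ b'.base} {g : b.total ⟶ b'.total}
    {f' : b'.base ⟶ b''.base} {g' : b'.total ⟶ b''.total} (h : IsHom b b' f g)
    (h' : IsHom b' b'' f' g') : IsHom b b'' (f ≫ f') (g ≫ g') where
  comp_q := by rw [Category.assoc, h'.comp_q, reassoc_of% h.comp_q]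
  zero_comp := by rw [reassoc_of% h.zero_comp, h'.zero_comp, Category.assoc]
  sum_comp := by
    obtain ⟨g₂, h1, h2⟩ := h.sum_comp
    obtain ⟨k₂, h3, h4⟩ := h'.sum_comp
    refine ⟨g₂ ≫ k₂, fun i => ?_, ?_⟩
    · rw [Category.assoc, h3, reassoc_of% h1]
    · rw [reassoc_of% h2, h4, Category.assoc]

lemma IsHom.map {b b' : Bundle C} {f : b.base ⟶ b'.base} {g : b.total ⟶ b'.total}
    (h : IsHom b b' f g) (F : C ⥤ D) : IsHom (b.map F) (b'.map F) (F.map f) (F.map g) where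
  comp_q := by
    have := congrArg F.map h.comp_q
    rwa [F.map_comp, F.map_comp] at this
  zero_comp := by
    have := congrArg F.map h.zero_comp
    rwa [F.map_comp, F.map_comp] at this
  sum_comp := by
    obtain ⟨g₂, h1, h2⟩ := h.sum_comp
    refine ⟨F.map g₂, fun i => ?_, ?_⟩
    · have := congrArg F.map (h1 i)
      rwa [F.map_comp, F.map_comp] at this
    · have := congrArg F.map h2
      rwa [F.map_comp, F.map_comp] at this

lemma IsHom.congr {b b' : Bundle C} {f f' : b.base ⟶ b'.base} {g g' : b.total ⟶ b'.total}
    (h : IsHom b b' f g) (hf : f = f') (hg : g = g') : IsHom b b' f' g' := by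
  subst hf hg; exact h

lemma isHom_app (b : Bundle C) {F G : C ⥤ D} (η : F ⟶ G) :
    IsHom (b.map F) (b.map G) (η.app b.base) (η.app b.total) where
  comp_q := (η.naturality b.q).symm
  zero_comp := η.naturality b.zero
  sum_comp := ⟨η.app (b.nfold 2), fun i => (η.naturality (b.π 2 i)).symm, η.naturality b.sum⟩

end Bundle

/-! ### Tangent structures and tangentads -/

section Tangentads

variable {K : Type u} [Bicategory.{w, v} K]

/-- The iterates `Tⁿ` of a 1-endomorphism. -/
def iter {X : K} (T : X ⟶ X) : ℕ → (X ⟶ X)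
  | 0 => 𝟙 X
  | n + 1 => iter T n ≫ T

/-- The data of a tangent structure on an object `X`. -/
structure TangentData (X : K) where
  /-- tangent bundle 1-morphism -/
  T : X ⟶ X
  /-- projection -/
  p : T ⟶ 𝟙 X
  /-- the `n`-fold pullbacks `T_n` of the projection along itself -/
  Tn : ℕ → (X ⟶ X)
  pn : ∀ n, Tn n ⟶ 𝟙 X
  π : ∀ n, Fin n → (Tn n ⟶ T)
  π_p : ∀ n i, π n i ≫ p = pn n
  /-- zero morphism -/
  z : 𝟙 X ⟶ T
  /-- sum morphism -/
  s : Tn 2 ⟶ T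
  /-- vertical lift -/
  l : T ⟶ T ≫ T
  /-- canonical flip -/
  c : T ≫ T ⟶ T ≫ T

/-- The bundle `𝐩 = (p, z, s)` in the category `End(X)`. -/
@[simps]
def TangentData.bundle {X : K} (t : TangentData X) : Bundle (X ⟶ X) where
  base := 𝟙 X
  total := t.T
  q := t.p
  nfold := t.Tn
  nbase := t.pn
  π := t.π
  π_q := t.π_p
  zero := t.z
  sum := t.s

/-- A tangent structure on an object `X` of `K`. Here `f ▷ T` is `T f`, `T ◁ f` is `f_T`, and
`pointwise` means: after precomposition with an arbitrary 1-morphism `F : Y ⟶ X`. -/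
structure TangentStructure (X : K) extends TangentData X where
  isAdditive : toTangentData.bundle.IsAdditive
  /-- The `n`-fold pullbacks are pointwise and preserved by all iterates of `T`. -/
  isNFoldPullback : ∀ (n m : ℕ) {Y : K} (F : Y ⟶ X),
    ((toTangentData.bundle.map (postcomp X (iter T m))).map (precomp X F)).IsNFoldPullback n
  /-- `(z, l) : 𝐩 ⟶ T𝐩` is an additive bundle morphism. -/
  lift_isHom : Bundle.IsHom toTangentData.bundle (toTangentData.bundle.map (postcomp X T))
    (z ≫ (λ_ T).inv) l
  /-- `(id, c) : T𝐩 ⟶ 𝐩_T` is an additive bundle morphism. -/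
  flip_isHom : Bundle.IsHom (toTangentData.bundle.map (postcomp X T))
    (toTangentData.bundle.map (precomp X T)) ((λ_ T).hom ≫ (ρ_ T).inv) c
  lift_lift : l ≫ l ▷ T = l ≫ T ◁ l ≫ (α_ T T T).inv
  lift_flip : l ≫ c = l
  flip_lift : T ◁ l ≫ (α_ T T T).inv ≫ c ▷ T ≫ (α_ T T T).hom ≫ T ◁ c =
    c ≫ l ▷ T ≫ (α_ T T T).hom
  flip_flip : c ≫ c = 𝟙 (T ≫ T)
  yang_baxter :
    c ▷ T ≫ (α_ T T T).hom ≫ T ◁ c ≫ (α_ T T T).inv ≫ c ▷ T =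
      (α_ T T T).hom ≫ T ◁ c ≫ (α_ T T T).inv ≫ c ▷ T ≫ (α_ T T T).hom ≫ T ◁ c ≫ (α_ T T T).inv
  /-- Universality of the vertical lift. The 2-morphism `k` is `z_T × l : T₂ ⇒ T ∘ T₂`. -/
  lift_universal : ∃ k : Tn 2 ⟶ Tn 2 ≫ T,
    k ≫ π 2 0 ▷ T = π 2 0 ≫ (ρ_ T).inv ≫ T ◁ z ∧
    k ≫ π 2 1 ▷ T = π 2 1 ≫ l ∧
    ∀ {Y : K} (F : Y ⟶ X),
      IsPullback (F ◁ (k ≫ s ▷ T)) (F ◁ pn 2) (F ◁ (p ▷ T)) (F ◁ (z ≫ (λ_ T).inv))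

variable (K) in
/-- A tangentad of `K`: an object with a tangent structure. As a type, these are the objects of the
2-category `Tng(K)`. -/
structure Tangentad where
  obj : K
  str : TangentStructure obj

/-- For `α : F ∘ T ⇒ T' ∘ F`, the 2-morphism `T'α ∘ α_T : F ∘ T² ⇒ T'² ∘ F`. -/
def law₂ {X X' : K} {T : X ⟶ X} {T' : X' ⟶ X'} {F : X ⟶ X'} (α : T ≫ F ⟶ F ≫ T') :
    (T ≫ T) ≫ F ⟶ F ≫ T' ≫ T' :=
  (α_ T T F).hom ≫ T ◁ α ≫ (α_ T F T').inv ≫ α ▷ T' ≫ (α_ F T' T').hom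

/-- `α : F ∘ T ⇒ T' ∘ F` is a lax distributive law. -/
structure IsLax (A B : Tangentad K) (F : A.obj ⟶ B.obj) (α : A.str.T ≫ F ⟶ F ≫ B.str.T) :
    Prop where
  additive : Bundle.IsHom (A.str.bundle.map (postcomp A.obj F))
    (B.str.bundle.map (precomp B.obj F)) ((λ_ F).hom ≫ (ρ_ F).inv) α
  lift : A.str.l ▷ F ≫ law₂ α = α ≫ F ◁ B.str.l
  flip : A.str.c ▷ F ≫ law₂ α = law₂ α ≫ F ◁ B.str.c

/-- The distributive law of a composite of lax tangent 1-morphisms. -/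
abbrev lawComp {X Y Z : K} {T : X ⟶ X} {T' : Y ⟶ Y} {T'' : Z ⟶ Z} {F : X ⟶ Y} {G : Y ⟶ Z}
    (α : T ≫ F ⟶ F ≫ T') (β : T' ≫ G ⟶ G ≫ T'') : T ≫ F ≫ G ⟶ (F ≫ G) ≫ T'' :=
  (α_ _ _ _).inv ≫ α ▷ G ≫ (α_ _ _ _).hom ≫ F ◁ β ≫ (α_ _ _ _).inv

lemma law₂_lawComp {X Y Z : K} {T : X ⟶ X} {T' : Y ⟶ Y} {T'' : Z ⟶ Z} {F : X ⟶ Y} {G : Y ⟶ Z}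
    (α : T ≫ F ⟶ F ≫ T') (β : T' ≫ G ⟶ G ≫ T'') :
    law₂ (lawComp α β) = lawComp (law₂ α) (law₂ β) := by
  have h := whisker_exchange α β
  simp only [law₂, lawComp]
  calc _ = 𝟙 _ ⊗≫ T ◁ α ▷ G ⊗≫ (((T ≫ F) ◁ β) ≫ (α ▷ (G ≫ T''))) ⊗≫ F ◁ β ▷ T'' ⊗≫ 𝟙 _ := by
        bicategory
    _ = _ := by
        rw [h]; bicategory

lemma lawComp_paste {X Y Z : K} {S T : X ⟶ X} {S' T' : Y ⟶ Y} {S'' T'' : Z ⟶ Z} {F : X ⟶ Y}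
    {G : Y ⟶ Z} {α : T ≫ F ⟶ F ≫ T'} {β : T' ≫ G ⟶ G ≫ T''} {α' : S ≫ F ⟶ F ≫ S'}
    {β' : S' ≫ G ⟶ G ≫ S''} {l : T ⟶ S} {l' : T' ⟶ S'} {l'' : T'' ⟶ S''}
    (h : l ▷ F ≫ α' = α ≫ F ◁ l') (h' : l' ▷ G ≫ β' = β ≫ G ◁ l'') :
    l ▷ (F ≫ G) ≫ lawComp α' β' = lawComp α β ≫ (F ≫ G) ◁ l'' := by
  simp only [lawComp]
  calc _ = 𝟙 _ ⊗≫ ((l ▷ F ≫ α') ▷ G) ⊗≫ F ◁ β' ⊗≫ 𝟙 _ := by bicategory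
    _ = 𝟙 _ ⊗≫ (α ▷ G) ⊗≫ F ◁ (l' ▷ G ≫ β') ⊗≫ 𝟙 _ := by rw [h]; bicategory
    _ = _ := by rw [h']; bicategory

lemma whiskerLeft_compat {X Y Z : K} {T : X ⟶ X} {T' : Y ⟶ Y} {T'' : Z ⟶ Z} {F : X ⟶ Y}
    {G H : Y ⟶ Z} (α : T ≫ F ⟶ F ≫ T') {β : T' ≫ G ⟶ G ≫ T''} {γ : T' ≫ H ⟶ H ≫ T''}
    {η : G ⟶ H} (h : β ≫ η ▷ T'' = T' ◁ η ≫ γ) :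
    lawComp α β ≫ (F ◁ η) ▷ T'' = T ◁ (F ◁ η) ≫ lawComp α γ := by
  simp only [lawComp]
  calc _ = 𝟙 _ ⊗≫ α ▷ G ⊗≫ F ◁ (β ≫ η ▷ T'') ⊗≫ 𝟙 _ := by bicategory
    _ = 𝟙 _ ⊗≫ (α ▷ G ≫ (F ≫ T') ◁ η) ⊗≫ F ◁ γ ⊗≫ 𝟙 _ := by rw [h]; bicategory
    _ = _ := by rw [← whisker_exchange]; bicategory

lemma whiskerRight_compat {X Y Z : K} {T : X ⟶ X} {T' : Y ⟶ Y} {T'' : Z ⟶ Z} {F G : X ⟶ Y}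
    {H : Y ⟶ Z} {α : T ≫ F ⟶ F ≫ T'} {β : T ≫ G ⟶ G ≫ T'} (γ : T' ≫ H ⟶ H ≫ T'')
    {η : F ⟶ G} (h : α ≫ η ▷ T' = T ◁ η ≫ β) :
    lawComp α γ ≫ (η ▷ H) ▷ T'' = T ◁ (η ▷ H) ≫ lawComp β γ := by
  simp only [lawComp]
  calc _ = 𝟙 _ ⊗≫ α ▷ H ⊗≫ (F ◁ γ ≫ η ▷ (H ≫ T'')) ⊗≫ 𝟙 _ := by bicategory
    _ = 𝟙 _ ⊗≫ (α ≫ η ▷ T') ▷ H ⊗≫ G ◁ γ ⊗≫ 𝟙 _ := by rw [whisker_exchange]; bicategory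
    _ = _ := by rw [h]; bicategory

lemma associator_compat {X Y Z W : K} {T : X ⟶ X} {T' : Y ⟶ Y} {T'' : Z ⟶ Z} {S : W ⟶ W}
    {F : X ⟶ Y} {G : Y ⟶ Z} {H : Z ⟶ W} (α : T ≫ F ⟶ F ≫ T') (β : T' ≫ G ⟶ G ≫ T'')
    (γ : T'' ≫ H ⟶ H ≫ S) :
    lawComp (lawComp α β) γ ≫ (α_ F G H).hom ▷ S =
      T ◁ (α_ F G H).hom ≫ lawComp α (lawComp β γ) := by
  simp only [lawComp]
  bicategory

lemma leftUnitor_compat {X Y : K} {T : X ⟶ X} {T' : Y ⟶ Y} {F : X ⟶ Y} (α : T ≫ F ⟶ F ≫ T') :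
    lawComp ((ρ_ T).hom ≫ (λ_ T).inv) α ≫ (λ_ F).hom ▷ T' = T ◁ (λ_ F).hom ≫ α := by
  simp only [lawComp]
  bicategory

lemma rightUnitor_compat {X Y : K} {T : X ⟶ X} {T' : Y ⟶ Y} {F : X ⟶ Y} (α : T ≫ F ⟶ F ≫ T') :
    lawComp α ((ρ_ T').hom ≫ (λ_ T').inv) ≫ (ρ_ F).hom ▷ T' = T ◁ (ρ_ F).hom ≫ α := by
  simp only [lawComp]
  bicategory

/-- Lax tangent 1-morphisms `(F, α)`. -/
structure LaxHom (A B : Tangentad K) where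
  hom : A.obj ⟶ B.obj
  law : A.str.T ≫ hom ⟶ hom ≫ B.str.T
  isLax : IsLax A B hom law

namespace LaxHom

/-- The identity tangent 1-morphism. -/
@[simps]
def id (A : Tangentad K) : LaxHom A A where
  hom := 𝟙 A.obj
  law := (ρ_ A.str.T).hom ≫ (λ_ A.str.T).inv
  isLax :=
    { additive := by
        have h := Bundle.isHom_app A.str.bundle
          ((rightUnitorNatIso A.obj A.obj).hom ≫ (leftUnitorNatIso A.obj A.obj).inv)
        refine h.congr ?_ rfl
        change (ρ_ (𝟙 A.obj)).hom ≫ (λ_ (𝟙 A.obj)).inv = (λ_ (𝟙 A.obj)).hom ≫ (ρ_ (𝟙 A.obj)).inv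
        simp [unitors_equal]
      lift := by
        simp [law₂]
      flip := by
        simp [law₂] }

/-- The composite of two lax tangent 1-morphisms. -/
@[simps]
def comp {A B C : Tangentad K} (F : LaxHom A B) (G : LaxHom B C) : LaxHom A C where
  hom := F.hom ≫ G.hom
  law := lawComp F.law G.law
  isLax :=
    { additive := by
        have h := ((((Bundle.isHom_app A.str.bundle
          (associatorNatIsoLeft A.obj F.hom G.hom).inv).comp
            (F.isLax.additive.map (postcomp A.obj G.hom))).comp
              (Bundle.isHom_app B.str.bundle (associatorNatIsoMiddle F.hom G.hom).hom)).comp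
                (G.isLax.additive.map (precomp C.obj F.hom))).comp
                  (Bundle.isHom_app C.str.bundle (associatorNatIsoRight F.hom G.hom C.obj).inv)
        refine h.congr ?_ ?_
        · change ((((α_ _ _ _).inv ≫ ((λ_ F.hom).hom ≫ (ρ_ F.hom).inv) ▷ G.hom) ≫
            (α_ _ _ _).hom) ≫ F.hom ◁ ((λ_ G.hom).hom ≫ (ρ_ G.hom).inv)) ≫ (α_ _ _ _).inv = _
          bicategory
        · change ((((α_ _ _ _).inv ≫ F.law ▷ G.hom) ≫
            (α_ _ _ _).hom) ≫ F.hom ◁ G.law) ≫ (α_ _ _ _).inv = _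
          simp [lawComp]
      lift := by
        rw [law₂_lawComp]
        exact lawComp_paste F.isLax.lift G.isLax.lift
      flip := by
        rw [law₂_lawComp]
        exact lawComp_paste F.isLax.flip G.isLax.flip }

/-- A strict tangent 1-morphism: its distributive law is the identity of the 1-morphism
`F ∘ T = T' ∘ F`. -/
def IsStrict {A B : Tangentad K} (F : LaxHom A B) : Prop :=
  ∃ h : A.str.T ≫ F.hom = F.hom ≫ B.str.T, F.law = eqToHom h

end LaxHom

/-- Compatibility of a 2-morphism with the distributive laws. -/
def IsCompatible {A B : Tangentad K} (F G : LaxHom A B) (φ : F.hom ⟶ G.hom) : Prop :=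
  F.law ≫ φ ▷ B.str.T = A.str.T ◁ φ ≫ G.law

/-- Tangent 2-morphisms. -/
@[ext]
structure TangentCell {A B : Tangentad K} (F G : LaxHom A B) where
  cell : F.hom ⟶ G.hom
  comm : IsCompatible F G cell

/-- The category of lax tangent 1-morphisms between two tangentads. -/
instance LaxHom.category (A B : Tangentad K) : Category (LaxHom A B) where
  Hom F G := TangentCell F G
  id F := ⟨𝟙 _, by simp [IsCompatible]⟩
  comp φ ψ := ⟨φ.cell ≫ ψ.cell, by
    have h1 := φ.comm
    have h2 := ψ.comm
    unfold IsCompatible at *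
    rw [comp_whiskerRight, reassoc_of% h1, h2, whiskerLeft_comp, Category.assoc]⟩
  id_comp φ := TangentCell.ext (Category.id_comp φ.cell)
  comp_id φ := TangentCell.ext (Category.comp_id φ.cell)
  assoc φ ψ χ := TangentCell.ext (Category.assoc φ.cell ψ.cell χ.cell)

@[simp]
lemma id_cell {A B : Tangentad K} (F : LaxHom A B) : TangentCell.cell (𝟙 F) = 𝟙 F.hom := rfl

@[simp]
lemma comp_cell {A B : Tangentad K} {F G H : LaxHom A B} (φ : F ⟶ G) (ψ : G ⟶ H) :
    TangentCell.cell (φ ≫ ψ) = TangentCell.cell φ ≫ TangentCell.cell ψ := rfl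

lemma cell_ext {A B : Tangentad K} {F G : LaxHom A B} {φ ψ : F ⟶ G}
    (h : TangentCell.cell φ = TangentCell.cell ψ) : φ = ψ := TangentCell.ext h

/-- An invertible 2-morphism compatible with the laws is an invertible tangent 2-morphism. -/
@[simps]
def LaxHom.isoMk {A B : Tangentad K} {F G : LaxHom A B} (e : F.hom ≅ G.hom)
    (h : IsCompatible F G e.hom) : F ≅ G where
  hom := ⟨e.hom, h⟩
  inv := ⟨e.inv, by
    unfold IsCompatible at *
    rw [← cancel_epi (A.str.T ◁ e.hom), ← reassoc_of% h]
    simp⟩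
  hom_inv_id := cell_ext e.hom_inv_id
  inv_hom_id := cell_ext e.inv_hom_id

/-- The 2-category `Tng(K)` of tangentads, lax tangent 1-morphisms and tangent 2-morphisms. -/
instance : Bicategory (Tangentad K) where
  Hom A B := LaxHom A B
  id A := LaxHom.id A
  comp F G := F.comp G
  homCategory A B := LaxHom.category A B
  whiskerLeft {_ _ _} F {_ _} η := ⟨F.hom ◁ η.cell, whiskerLeft_compat F.law η.comm⟩
  whiskerRight {_ _ _ _ _} η H := ⟨η.cell ▷ H.hom, whiskerRight_compat H.law η.comm⟩
  associator F G H := LaxHom.isoMk (α_ F.hom G.hom H.hom) (associator_compat F.law G.law H.law)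
  leftUnitor F := LaxHom.isoMk (λ_ F.hom) (leftUnitor_compat F.law)
  rightUnitor F := LaxHom.isoMk (ρ_ F.hom) (rightUnitor_compat F.law)
  whiskerLeft_id _ _ := cell_ext (Bicategory.whiskerLeft_id _ _)
  whiskerLeft_comp _ _ _ _ _ _ := cell_ext (Bicategory.whiskerLeft_comp _ _ _)
  id_whiskerLeft _ := cell_ext (Bicategory.id_whiskerLeft _)
  comp_whiskerLeft _ _ _ _ _ := cell_ext (Bicategory.comp_whiskerLeft _ _ _)
  id_whiskerRight _ _ := cell_ext (Bicategory.id_whiskerRight _ _)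
  comp_whiskerRight _ _ _ := cell_ext (Bicategory.comp_whiskerRight _ _ _)
  whiskerRight_id _ := cell_ext (Bicategory.whiskerRight_id _)
  whiskerRight_comp _ _ _ := cell_ext (Bicategory.whiskerRight_comp _ _ _)
  whisker_assoc _ _ _ _ _ := cell_ext (Bicategory.whisker_assoc _ _ _)
  whisker_exchange _ _ := cell_ext (Bicategory.whisker_exchange _ _)
  pentagon _ _ _ _ := cell_ext (Bicategory.pentagon _ _ _ _)
  triangle _ _ := cell_ext (Bicategory.triangle _ _)

/-! ### Vector fields -/

/-- The tangent bundle as a 1-morphism `(T, c) : (X, 𝕋) ⟶ (X, 𝕋)` of `Tng(K)`. The tangent bundle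
functor `T̄` of the Hom-tangent category `[A | X]` is postcomposition with it. -/
def tangentHom (X : Tangentad K) : X ⟶ X :=
  LaxHom.mk X.str.T X.str.c
    { additive := X.str.flip_isHom
      lift := by
        have h := X.str.flip_lift
        have h1 := X.str.flip_flip
        have h2 : X.str.T ◁ X.str.c ≫ X.str.T ◁ X.str.c = 𝟙 _ := by
          rw [← whiskerLeft_comp, h1, whiskerLeft_id]
        have h3 : X.str.c ▷ X.str.T ≫ X.str.c ▷ X.str.T = 𝟙 _ := by
          rw [← comp_whiskerRight, h1, id_whiskerRight]
        have h4 := congrArg (fun x => X.str.c ≫ x ≫ (α_ _ _ _).inv ≫ law₂ X.str.c) h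
        simp only [law₂, Category.assoc, Iso.inv_hom_id_assoc, reassoc_of% h1, reassoc_of% h2,
          Iso.hom_inv_id_assoc, reassoc_of% h3] at h4
        simp only [law₂, ← h4, Iso.inv_hom_id, Category.comp_id]
      flip := by
        have h := congrArg (fun x => x ≫ (α_ _ _ _).hom) X.str.yang_baxter
        simp only [Category.assoc, Iso.inv_hom_id, Category.comp_id] at h
        simp only [law₂, Category.assoc, h] }

/-- The projection as a 2-morphism `p : (T, c) ⇒ id` of `Tng(K)`. -/
def projCell (X : Tangentad K) : tangentHom X ⟶ 𝟙 X :=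
  TangentCell.mk (F := tangentHom X) (G := LaxHom.id X) X.str.p (by
    have h : X.str.c ≫ X.str.T ◁ X.str.p =
      X.str.p ▷ X.str.T ≫ (λ_ X.str.T).hom ≫ (ρ_ X.str.T).inv := X.str.flip_isHom.comp_q
    have h1 := X.str.flip_flip
    change X.str.c ≫ X.str.p ▷ X.str.T =
      X.str.T ◁ X.str.p ≫ (ρ_ X.str.T).hom ≫ (λ_ X.str.T).inv
    have h2 := congrArg (fun x => X.str.c ≫ x ≫ (ρ_ _).hom ≫ (λ_ _).inv) h
    simp only [Category.assoc, reassoc_of% h1, Iso.inv_hom_id_assoc, Iso.hom_inv_id,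
      Category.comp_id] at h2
    exact h2.symm)

/-- The canonical flip as a 2-morphism `c : (T, c)² ⇒ (T, c)²` of `Tng(K)`. -/
def flipCell (X : Tangentad K) : tangentHom X ≫ tangentHom X ⟶ tangentHom X ≫ tangentHom X :=
  TangentCell.mk (F := (tangentHom X).comp (tangentHom X)) (G := (tangentHom X).comp (tangentHom X))
    X.str.c (by
      have h := congrArg (fun x => (α_ _ _ _).inv ≫ x) X.str.yang_baxter
      simp only [Iso.inv_hom_id_assoc] at h
      change lawComp X.str.c X.str.c ≫ X.str.c ▷ X.str.T =
        X.str.T ◁ X.str.c ≫ lawComp X.str.c X.str.c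
      simpa only [lawComp, Category.assoc] using h)

/-- The distributive law of a lax tangent 1-morphism as a 2-morphism of `Tng(K)`. -/
def lawCell {A B : Tangentad K} (F : A ⟶ B) : tangentHom A ≫ F ⟶ F ≫ tangentHom B :=
  TangentCell.mk (F := (tangentHom A).comp F) (G := F.comp (tangentHom B)) F.law (by
    have h := congrArg (fun x => (α_ _ _ _).inv ≫ x ≫ (α_ _ _ _).inv) F.isLax.flip
    change lawComp A.str.c F.law ≫ F.law ▷ B.str.T = A.str.T ◁ F.law ≫ lawComp F.law B.str.c
    simp only [law₂, Category.assoc, Iso.inv_hom_id_assoc, Iso.hom_inv_id, Category.comp_id] at h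
    simpa only [lawComp, Category.assoc] using h)

lemma flipCell_flipCell (X : Tangentad K) : flipCell X ≫ flipCell X = 𝟙 _ :=
  cell_ext X.str.flip_flip

lemma flipCell_projCell (X : Tangentad K) :
    flipCell X ≫ tangentHom X ◁ projCell X =
      projCell X ▷ tangentHom X ≫ (λ_ (tangentHom X)).hom ≫ (ρ_ (tangentHom X)).inv :=
  cell_ext X.str.flip_isHom.comp_q

/-- A vector field in the Hom-tangent category `[A | X]` of lax tangent 1-morphisms from `A` to
`X`: a lax tangent 1-morphism `G` with a tangent 2-morphism `u : G ⇒ T̄G` which is a section of the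
projection `p_G : T̄G ⇒ G`. -/
structure VectorField (A X : Tangentad K) where
  hom : A ⟶ X
  field : hom ⟶ hom ≫ tangentHom X
  isSection : field ≫ hom ◁ projCell X ≫ (ρ_ hom).hom = 𝟙 hom

namespace VectorField

/-- Morphisms of vector fields. -/
@[ext]
structure Hom {A X : Tangentad K} (u u' : VectorField A X) where
  cell : u.hom ⟶ u'.hom
  comm : u.field ≫ cell ▷ tangentHom X = cell ≫ u'.field

/-- The category `VF[A | X]` of vector fields in the Hom-tangent category `[A | X]`. -/
instance category (A X : Tangentad K) : Category (VectorField A X) where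
  Hom u u' := Hom u u'
  id u := ⟨𝟙 _, by simp⟩
  comp φ ψ := ⟨φ.cell ≫ ψ.cell, by
    rw [comp_whiskerRight, reassoc_of% φ.comm, ψ.comm, Category.assoc]⟩
  id_comp φ := Hom.ext (Category.id_comp φ.cell)
  comp_id φ := Hom.ext (Category.comp_id φ.cell)
  assoc φ ψ χ := Hom.ext (Category.assoc φ.cell ψ.cell χ.cell)

section

variable {B : Type u₁} [Bicategory.{w, v} B] {Y Z X : B} {S : Z ⟶ Z} {T : X ⟶ X}

lemma section_tangent {p : T ⟶ 𝟙 X} {c : T ≫ T ⟶ T ≫ T}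
    (hc : c ≫ T ◁ p = p ▷ T ≫ (λ_ T).hom ≫ (ρ_ T).inv) {G : Y ⟶ X} {u : G ⟶ G ≫ T}
    (hu : u ≫ G ◁ p ≫ (ρ_ G).hom = 𝟙 G) :
    (u ▷ T ≫ (α_ _ _ _).hom ≫ G ◁ c ≫ (α_ _ _ _).inv) ≫ (G ≫ T) ◁ p ≫ (ρ_ (G ≫ T)).hom =
      𝟙 (G ≫ T) := by
  calc _ = u ▷ T ⊗≫ G ◁ (c ≫ T ◁ p) ⊗≫ 𝟙 _ := by bicategory
    _ = (u ≫ G ◁ p ≫ (ρ_ G).hom) ▷ T := by rw [hc]; bicategory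
    _ = _ := by rw [hu, id_whiskerRight]

lemma hom_tangent (c : T ≫ T ⟶ T ≫ T) {G G' : Y ⟶ X} {u : G ⟶ G ≫ T} {u' : G' ⟶ G' ≫ T}
    {φ : G ⟶ G'} (h : u ≫ φ ▷ T = φ ≫ u') :
    (u ▷ T ≫ (α_ _ _ _).hom ≫ G ◁ c ≫ (α_ _ _ _).inv) ≫ φ ▷ T ▷ T =
      φ ▷ T ≫ u' ▷ T ≫ (α_ _ _ _).hom ≫ G' ◁ c ≫ (α_ _ _ _).inv := by
  calc _ = u ▷ T ⊗≫ (G ◁ c ≫ φ ▷ (T ≫ T)) ⊗≫ 𝟙 _ := by bicategory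
    _ = (u ≫ φ ▷ T) ▷ T ⊗≫ G' ◁ c ⊗≫ 𝟙 _ := by rw [whisker_exchange]; bicategory
    _ = _ := by rw [h]; bicategory

lemma section_whisker {p : T ⟶ 𝟙 X} {G : Z ⟶ X} {u : G ⟶ G ≫ T}
    (hu : u ≫ G ◁ p ≫ (ρ_ G).hom = 𝟙 G) (H : Y ⟶ Z) :
    (H ◁ u ≫ (α_ _ _ _).inv) ≫ (H ≫ G) ◁ p ≫ (ρ_ (H ≫ G)).hom = 𝟙 (H ≫ G) := by
  calc _ = H ◁ (u ≫ G ◁ p ≫ (ρ_ G).hom) := by bicategory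
    _ = _ := by rw [hu, whiskerLeft_id]

lemma hom_whisker {G : Z ⟶ X} (u : G ⟶ G ≫ T) {H H' : Y ⟶ Z} (φ : H ⟶ H') :
    (H ◁ u ≫ (α_ _ _ _).inv) ≫ φ ▷ G ▷ T = φ ▷ G ≫ H' ◁ u ≫ (α_ _ _ _).inv := by
  calc _ = (H ◁ u ≫ φ ▷ (G ≫ T)) ⊗≫ 𝟙 _ := by bicategory
    _ = _ := by rw [whisker_exchange]; bicategory

lemma law_whisker {c : T ≫ T ⟶ T ≫ T} (hc : c ≫ c = 𝟙 _) {G : Z ⟶ X} {u : G ⟶ G ≫ T}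
    {β : S ≫ G ⟶ G ≫ T} (h : β ≫ u ▷ T =
      S ◁ u ≫ (α_ _ _ _).inv ≫ β ▷ T ≫ (α_ _ _ _).hom ≫ G ◁ c ≫ (α_ _ _ _).inv) (H : Y ⟶ Z) :
    ((H ≫ S) ◁ u ≫ (α_ _ _ _).inv) ≫ ((α_ _ _ _).hom ≫ H ◁ β ≫ (α_ _ _ _).inv) ▷ T =
      ((α_ _ _ _).hom ≫ H ◁ β ≫ (α_ _ _ _).inv) ≫ (H ◁ u ≫ (α_ _ _ _).inv) ▷ T ≫
        (α_ _ _ _).hom ≫ (H ≫ G) ◁ c ≫ (α_ _ _ _).inv := by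
  calc _ = 𝟙 _ ⊗≫ H ◁ (S ◁ u ≫ (α_ _ _ _).inv ≫ β ▷ T ≫ (α_ _ _ _).hom ≫ G ◁ (c ≫ c) ≫
          (α_ _ _ _).inv) ⊗≫ 𝟙 _ := by rw [hc]; bicategory
    _ = 𝟙 _ ⊗≫ H ◁ (S ◁ u ≫ (α_ _ _ _).inv ≫ β ▷ T ≫ (α_ _ _ _).hom ≫ G ◁ c ≫
          (α_ _ _ _).inv) ⊗≫ H ◁ G ◁ c ⊗≫ 𝟙 _ := by bicategory
    _ = _ := by rw [← h]; bicategory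

lemma law_natural {G : Z ⟶ X} (β : S ≫ G ⟶ G ≫ T) {H H' : Y ⟶ Z} (φ : H ⟶ H') :
    φ ▷ S ▷ G ≫ (α_ _ _ _).hom ≫ H' ◁ β ≫ (α_ _ _ _).inv =
      ((α_ _ _ _).hom ≫ H ◁ β ≫ (α_ _ _ _).inv) ≫ φ ▷ G ▷ T := by
  calc _ = 𝟙 _ ⊗≫ (φ ▷ (S ≫ G) ≫ H' ◁ β) ⊗≫ 𝟙 _ := by bicategory
    _ = _ := by rw [← whisker_exchange]; bicategory

end

/-- The tangent bundle functor of `VF[A | X]`: it sends `(G, u)` to `(T̄G, c_G ∘ T̄u)`. -/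
def tangentFunctor (A X : Tangentad K) : VectorField A X ⥤ VectorField A X where
  obj u :=
    { hom := u.hom ≫ tangentHom X
      field := u.field ▷ tangentHom X ≫ (α_ _ _ _).hom ≫ u.hom ◁ flipCell X ≫ (α_ _ _ _).inv
      isSection := section_tangent (flipCell_projCell X) u.isSection }
  map φ := ⟨φ.cell ▷ tangentHom X, hom_tangent (flipCell X) φ.comm⟩
  map_id u := Hom.ext (id_whiskerRight u.hom (tangentHom X))
  map_comp φ ψ := Hom.ext (comp_whiskerRight φ.cell ψ.cell (tangentHom X))

/-- The functor `Γ_u : [A | B] ⥤ VF[A | X]` induced by a vector field `(G, u)` in `[B | X]`: it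
sends `H` to `(G ∘ H, u_H)` and `φ` to `G φ`. -/
def Γ {B X : Tangentad K} (u : VectorField B X) (A : Tangentad K) : (A ⟶ B) ⥤ VectorField A X where
  obj H := ⟨H ≫ u.hom, H ◁ u.field ≫ (α_ _ _ _).inv, section_whisker u.isSection H⟩
  map φ := ⟨φ ▷ u.hom, hom_whisker u.field φ⟩
  map_id H := Hom.ext (id_whiskerRight H u.hom)
  map_comp φ ψ := Hom.ext (comp_whiskerRight φ ψ u.hom)

/-- The distributive law `Γ_u ∘ T̄ ⇒ T^VF ∘ Γ_u` of the functor `Γ_u`, given at `H` by `β_H`, where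
`β` is the distributive law of `G`. -/
def Γlaw {B X : Tangentad K} (u : VectorField B X) (A : Tangentad K) :
    postcomp A (tangentHom B) ⋙ u.Γ A ⟶ u.Γ A ⋙ tangentFunctor A X where
  app H :=
    { cell := (α_ _ _ _).hom ≫ H ◁ lawCell u.hom ≫ (α_ _ _ _).inv
      comm := by
        have h : lawCell u.hom ≫ u.field ▷ tangentHom X =
            tangentHom B ◁ u.field ≫ (α_ _ _ _).inv ≫ lawCell u.hom ▷ tangentHom X ≫
              (α_ _ _ _).hom ≫ u.hom ◁ flipCell X ≫ (α_ _ _ _).inv := cell_ext u.field.comm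
        exact law_whisker (flipCell_flipCell X) h H }
  naturality _ _ φ := Hom.ext (law_natural (lawCell u.hom) φ)

/-- `(E, U, v)` is the tangentad of vector fields of `X`, with universal vector field `v`: the
tangent 1-morphism `U` is strict and, for each tangentad `A`, the induced tangent functor `Γ_v` from
`[A | E]` to `VF[A | X]` is invertible, i.e. its underlying functor is an isomorphism of categories
and its distributive law is invertible. -/
def IsUniversal {E X : Tangentad K} (v : VectorField E X) : Prop :=
  LaxHom.IsStrict v.hom ∧ ∀ A : Tangentad K, IsIsoOfCategories (v.Γ A) ∧ IsIso (v.Γlaw A)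

end VectorField

/-- The tangentad `X` admits the construction of vector fields. -/
def AdmitsVectorFields (X : Tangentad K) : Prop :=
  ∃ (E : Tangentad K) (v : VectorField E X), v.IsUniversal

/-- For `p : T ⇒ id` and `θ : V ⇒ T ∘ V`, the 2-morphism `p_V ∘ θ : V ⇒ V`. -/
def projected {B : Type u₁} [Bicategory.{w, v} B] {X I : B} {T : X ⟶ X} (p : T ⟶ 𝟙 X) {V : I ⟶ X}
    (θ : V ≫ 𝟙 X ⟶ V ≫ T) : V ⟶ V :=
  (ρ_ V).inv ≫ θ ≫ V ◁ p ≫ (ρ_ V).hom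

end Tangentads

end Tng
open Tng

/-! A 1-morphism into the inserter `I` is a `T`-coalgebra `H ⇒ T ∘ H`. If an endomorphism `A` of `X`
carries a law `d : A ∘ T ⇒ T ∘ A`, then `(V, θ) ↦ (A ∘ V, d_V · Aθ)` sends coalgebras to coalgebras
and so lifts `A` to `I`. A 2-morphism that commutes with such laws lifts as well
(`IsInserter.exists_isCoalgSq`, `IsInserter.exists_over`). The flip `c` is a law for `T`, its
componentwise version is a law for `T_n`, and the flip axioms say that `p, z, s, l, c` commute with
these laws. Hence all the data of the tangent structure lift.

Equations lift because whiskering with `V` is faithful. Limits lift because a map `m` between lifted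
objects is a coalgebra map as soon as it becomes one after composing with a family whose `T`-images
are jointly monic; this is abstracted in `Reflects`. For the pullbacks `T_n` joint monicity holds
because `T` preserves them. For the universality square of the vertical lift preservation by `T` is
not assumed, but the flip turns `T` of that square into the square precomposed with `T`, which is a
pullback by pointwiseness (`TangentStructure.lift_jointly_monic`).

Locally the equifier `W` is the inclusion of a full subcategory, so the structure restricts to `E`
once `T` and the `T_n` restrict. They do, because the lifting squares conjugate `p_V · θ` whiskered
with the lift of `A` into `A (p_V · θ)`.

A law for a 1-morphism `F` into `I` is determined by the law of `V ∘ F`; it exists because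
compatibility of `θ_F` with that law is, up to `c² = id`, the condition of being a coalgebra map.
This gives the inserter in `Tng(K)`, and the equifier is similar. A vector field is then a coalgebra
in `Tng(K)` whose section condition is the equifier condition, and the law of `Γ_v` is invertible
because `V ∘ W` is strict. Strictness of `K` enters only in this last part, to treat associators as
identities. -/

namespace Tng

/-! ### Isomorphisms of categories as functors bijective on objects and morphisms. -/

section Categories

variable {C : Type u₁} [Category.{v₁} C] {D : Type u₂} [Category.{v₂} D]

lemma isIsoOfCategories_of_bijective (F : C ⥤ D) (hF : Function.Bijective F.obj)
    (h : ∀ X Y : C, Function.Bijective (F.map : (X ⟶ Y) → (F.obj X ⟶ F.obj Y))) :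
    IsIsoOfCategories F := by
  obtain ⟨g, hg₁, hg₂⟩ := Function.bijective_iff_has_inverse.1 hF
  have : F.Full := ⟨fun {X Y} => (h X Y).2⟩
  have : F.Faithful := ⟨fun {X Y} => @((h X Y).1)⟩
  let G : D ⥤ C :=
    { obj := g
      map := fun {X Y} f => F.preimage (eqToHom (hg₂ X) ≫ f ≫ eqToHom (hg₂ Y).symm)
      map_id := fun X => F.map_injective (by simp)
      map_comp := fun f f' => F.map_injective (by simp) }
  refine ⟨G, ?_, ?_⟩
  · refine CategoryTheory.Functor.ext hg₁ fun X Y f => F.map_injective ?_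
    simp [G, eqToHom_map]
  · refine CategoryTheory.Functor.ext hg₂ fun X Y f => ?_
    simp [G]

lemma IsIsoOfCategories.bijective_obj {F : C ⥤ D} (h : IsIsoOfCategories F) :
    Function.Bijective F.obj := by
  obtain ⟨G, h₁, h₂⟩ := h
  exact Function.bijective_iff_has_inverse.2
    ⟨G.obj, fun X => Functor.congr_obj h₁ X, fun X => Functor.congr_obj h₂ X⟩

lemma IsIsoOfCategories.bijective_map {F : C ⥤ D} (h : IsIsoOfCategories F) (X Y : C) :
    Function.Bijective (F.map : (X ⟶ Y) → (F.obj X ⟶ F.obj Y)) := by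
  obtain ⟨G, h₁, h₂⟩ := h
  let e : C ≌ D := CategoryTheory.Equivalence.mk F G (eqToIso h₁.symm) (eqToIso h₂)
  exact ⟨fun _ _ hf => e.functor.map_injective hf, fun f => e.functor.map_surjective f⟩

lemma map_comm_sq (F : C ⥤ D) {W X Y Z : C} {f : W ⟶ X} {g : X ⟶ Z} {h : W ⟶ Y} {k : Y ⟶ Z}
    (e : f ≫ g = h ≫ k) : F.map f ≫ F.map g = F.map h ≫ F.map k := by
  rw [← F.map_comp, e, F.map_comp]

end Categories

/-! ### Transport and reflection of additive bundles along isomorphisms and faithful functors. -/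

namespace Bundle

variable {C : Type u₁} [Category.{v₁} C] {D : Type u₂} [Category.{v₂} D]

/-- The base component `y` is a separate datum: for `n = 0` no `x i` determines it. -/
lemma isNFoldPullback_iff (b : Bundle C) (n : ℕ) :
    b.IsNFoldPullback n ↔ ∀ ⦃Z : C⦄ (y : Z ⟶ b.base) (x : Fin n → (Z ⟶ b.total)),
      (∀ i, x i ≫ b.q = y) →
        ∃! m : Z ⟶ b.nfold n, m ≫ b.nbase n = y ∧ ∀ i, m ≫ b.π n i = x i := by
  constructor
  · rintro ⟨h⟩ Z y x hx
    refine ⟨h.lift (WidePullbackCone.mk y x hx), ⟨h.fac _ none, fun i => h.fac _ (some i)⟩, ?_⟩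
    rintro m ⟨h₁, h₂⟩
    refine h.uniq (WidePullbackCone.mk y x hx) m ?_
    rintro (_ | i)
    · exact h₁
    · exact h₂ i
  · intro h
    have key : ∀ s : WidePullbackCone (fun _ : Fin n => b.q),
        ∃! m : s.pt ⟶ b.nfold n, m ≫ b.nbase n = (Cone.π s).app none ∧
          ∀ i, m ≫ b.π n i = (Cone.π s).app (some i) :=
      fun s => h _ _ fun i => s.w (WidePullbackShape.Hom.term i)
    choose m hm hm' using key
    refine ⟨⟨m, ?_, ?_⟩⟩
    · rintro s (_ | i)
      · exact (hm s).1
      · exact (hm s).2 i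
    · intro s k hk
      exact hm' s k ⟨hk none, fun i => hk (some i)⟩

lemma IsNFoldPullback.hom_ext {b : Bundle C} {n : ℕ} (h : b.IsNFoldPullback n) {Z : C}
    {f g : Z ⟶ b.nfold n} (h₀ : f ≫ b.nbase n = g ≫ b.nbase n)
    (h₁ : ∀ i, f ≫ b.π n i = g ≫ b.π n i) : f = g :=
  ((b.isNFoldPullback_iff n).1 h (g ≫ b.nbase n) (fun i => g ≫ b.π n i)
    (fun i => by rw [Category.assoc, b.π_q])).unique ⟨h₀, h₁⟩ ⟨rfl, fun _ => rfl⟩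

lemma IsNFoldPullback.hom_ext₂ {b : Bundle C} (h : b.IsNFoldPullback 2) {Z : C}
    {f g : Z ⟶ b.nfold 2} (h₁ : ∀ i, f ≫ b.π 2 i = g ≫ b.π 2 i) : f = g :=
  h.hom_ext (by rw [← b.π_q 2 0, ← Category.assoc, h₁, Category.assoc]) h₁

lemma IsNFoldPullback.exists_lift {b : Bundle C} {n : ℕ} (h : b.IsNFoldPullback n) {Z : C}
    (y : Z ⟶ b.base) (x : Fin n → (Z ⟶ b.total)) (hx : ∀ i, x i ≫ b.q = y) :
    ∃ m : Z ⟶ b.nfold n, m ≫ b.nbase n = y ∧ ∀ i, m ≫ b.π n i = x i :=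
  ((b.isNFoldPullback_iff n).1 h y x hx).exists

/-- An isomorphism of bundle data. -/
structure Iso (b b' : Bundle C) where
  base : b.base ≅ b'.base
  total : b.total ≅ b'.total
  nfold : ∀ n, b.nfold n ≅ b'.nfold n
  q : total.hom ≫ b'.q = b.q ≫ base.hom
  nbase : ∀ n, (nfold n).hom ≫ b'.nbase n = b.nbase n ≫ base.hom
  π : ∀ n i, (nfold n).hom ≫ b'.π n i = b.π n i ≫ total.hom
  zero : base.hom ≫ b'.zero = b.zero ≫ total.hom
  sum : (nfold 2).hom ≫ b'.sum = b.sum ≫ total.hom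

namespace Iso

/-- The inverse isomorphism. -/
@[simps]
def symm {b b' : Bundle C} (e : Iso b b') : Iso b' b where
  base := e.base.symm
  total := e.total.symm
  nfold n := (e.nfold n).symm
  q := by simp [Iso.inv_comp_eq, reassoc_of% e.q]
  nbase n := by simp [Iso.inv_comp_eq, reassoc_of% e.nbase n]
  π n i := by simp [Iso.inv_comp_eq, reassoc_of% e.π n i]
  zero := by simp [Iso.inv_comp_eq, reassoc_of% e.zero]
  sum := by simp [Iso.inv_comp_eq, reassoc_of% e.sum]

/-- The composite of two isomorphisms. -/
def trans {b b' b'' : Bundle C} (e : Iso b b') (e' : Iso b' b'') : Iso b b'' where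
  base := e.base ≪≫ e'.base
  total := e.total ≪≫ e'.total
  nfold n := e.nfold n ≪≫ e'.nfold n
  q := by simp [e'.q, reassoc_of% e.q]
  nbase n := by simp [e'.nbase, reassoc_of% e.nbase n]
  π n i := by simp [e'.π, reassoc_of% e.π n i]
  zero := by simp [e'.zero, reassoc_of% e.zero]
  sum := by simp [e'.sum, reassoc_of% e.sum]

/-- The image of an isomorphism under a functor. -/
def map {b b' : Bundle C} (e : Iso b b') (F : C ⥤ D) : Iso (b.map F) (b'.map F) where
  base := F.mapIso e.base
  total := F.mapIso e.total
  nfold n := F.mapIso (e.nfold n)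
  q := map_comm_sq F e.q
  nbase n := map_comm_sq F (e.nbase n)
  π n i := map_comm_sq F (e.π n i)
  zero := map_comm_sq F e.zero
  sum := map_comm_sq F e.sum

/-- The isomorphism of images under naturally isomorphic functors. -/
def ofNatIso (b : Bundle C) {F G : C ⥤ D} (η : F ≅ G) : Iso (b.map F) (b.map G) where
  base := η.app _
  total := η.app _
  nfold _ := η.app _
  q := (η.hom.naturality _).symm
  nbase _ := (η.hom.naturality _).symm
  π _ _ := (η.hom.naturality _).symm
  zero := (η.hom.naturality _).symm
  sum := (η.hom.naturality _).symm

lemma isHom {b b' : Bundle C} (e : Iso b b') : IsHom b b' e.base.hom e.total.hom where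
  comp_q := e.q
  zero_comp := e.zero.symm
  sum_comp := ⟨(e.nfold 2).hom, fun i => e.π 2 i, e.sum.symm⟩

end Iso

lemma IsNFoldPullback.of_iso {b b' : Bundle C} (e : Iso b b') {n : ℕ}
    (h : b.IsNFoldPullback n) : b'.IsNFoldPullback n := by
  rw [isNFoldPullback_iff]
  intro Z y x hx
  obtain ⟨m, h₁, h₂⟩ := h.exists_lift (y ≫ e.base.inv) (fun i => x i ≫ e.total.inv)
    (fun i => by
      have := e.symm.q
      simp only [Iso.symm_base, Iso.symm_total, CategoryTheory.Iso.symm_hom] at this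
      rw [Category.assoc, this, ← hx i, Category.assoc])
  refine ⟨m ≫ (e.nfold n).hom, ⟨?_, fun i => ?_⟩, ?_⟩
  · rw [Category.assoc, e.nbase, reassoc_of% h₁]; simp
  · rw [Category.assoc, e.π, reassoc_of% h₂ i]; simp
  · rintro k ⟨h₃, h₄⟩
    rw [← Iso.comp_inv_eq]
    apply h.hom_ext
    · have := e.symm.nbase n
      simp only [Iso.symm_nfold, Iso.symm_base, CategoryTheory.Iso.symm_hom] at this
      rw [Category.assoc, this, h₁, reassoc_of% h₃]
    · intro i
      have := e.symm.π n i
      simp only [Iso.symm_nfold, Iso.symm_total, CategoryTheory.Iso.symm_hom] at this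
      rw [Category.assoc, this, h₂, reassoc_of% h₄ i]

/-- The relation `x + y = w`. -/
def IsSum (b : Bundle C) {Z : C} (x y w : Z ⟶ b.total) : Prop :=
  ∃ m : Z ⟶ b.nfold 2, m ≫ b.π 2 0 = x ∧ m ≫ b.π 2 1 = y ∧ m ≫ b.sum = w

section IsSum

variable {b b' : Bundle C}

lemma IsSum.unique (hb : b.IsNFoldPullback 2) {Z : C} {x y w w' : Z ⟶ b.total}
    (h : b.IsSum x y w) (h' : b.IsSum x y w') : w = w' := by
  obtain ⟨m, h₁, h₂, h₃⟩ := h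
  obtain ⟨m', h₁', h₂', h₃'⟩ := h'
  have : m = m' := hb.hom_ext₂ (Fin.forall_fin_two.2 ⟨h₁.trans h₁'.symm, h₂.trans h₂'.symm⟩)
  rw [← h₃, ← h₃', this]

lemma isSum_add (hb : b.IsNFoldPullback 2) {Z : C} (x y : Z ⟶ b.total)
    (h : x ≫ b.q = y ≫ b.q) : b.IsSum x y (add hb x y h) :=
  ⟨pair hb x y h, pair_fst hb x y h, pair_snd hb x y h, rfl⟩

/-- The term `add` contains a chosen lift and proofs, and does not transport well; the relation
`IsSum` is preserved by any functor and any bundle morphism. This equivalence passes between the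
two. -/
lemma isSum_iff (hb : b.IsNFoldPullback 2) {Z : C} {x y w : Z ⟶ b.total}
    (h : x ≫ b.q = y ≫ b.q) : b.IsSum x y w ↔ add hb x y h = w :=
  ⟨fun hw => (isSum_add hb x y h).unique hb hw, fun hw => hw ▸ isSum_add hb x y h⟩

lemma isSum_sum (b : Bundle C) : b.IsSum (b.π 2 0) (b.π 2 1) b.sum := ⟨𝟙 _, by simp⟩

lemma IsSum.comp {Z Z' : C} {x y w : Z ⟶ b.total} (h : b.IsSum x y w) (f : Z' ⟶ Z) :
    b.IsSum (f ≫ x) (f ≫ y) (f ≫ w) := by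
  obtain ⟨m, rfl, rfl, rfl⟩ := h
  exact ⟨f ≫ m, by simp⟩

lemma IsSum.map {Z : C} {x y w : Z ⟶ b.total} (h : b.IsSum x y w) (F : C ⥤ D) :
    (b.map F).IsSum (F.map x) (F.map y) (F.map w) := by
  obtain ⟨m, rfl, rfl, rfl⟩ := h
  exact ⟨F.map m, (F.map_comp _ _).symm, (F.map_comp _ _).symm, (F.map_comp _ _).symm⟩

lemma IsSum.of_isHom {f : b.base ⟶ b'.base} {g : b.total ⟶ b'.total} (hg : IsHom b b' f g)
    {Z : C} {x y w : Z ⟶ b.total} (h : b.IsSum x y w) : b'.IsSum (x ≫ g) (y ≫ g) (w ≫ g) := by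
  obtain ⟨m, rfl, rfl, rfl⟩ := h
  obtain ⟨g₂, h₁, h₂⟩ := hg.sum_comp
  exact ⟨m ≫ g₂, by simp [h₁, h₂]⟩

end IsSum

lemma isHom_iff {b b' : Bundle C} (f : b.base ⟶ b'.base) (g : b.total ⟶ b'.total) :
    IsHom b b' f g ↔ g ≫ b'.q = b.q ≫ f ∧ b.zero ≫ g = f ≫ b'.zero ∧
      b'.IsSum (b.π 2 0 ≫ g) (b.π 2 1 ≫ g) (b.sum ≫ g) := by
  constructor
  · exact fun h => ⟨h.comp_q, h.zero_comp, b.isSum_sum.of_isHom h⟩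
  · rintro ⟨h₁, h₂, m, h₃, h₄, h₅⟩
    exact ⟨h₁, h₂, m, Fin.forall_fin_two.2 ⟨h₃, h₄⟩, h₅.symm⟩

/-- The axioms of an additive bundle in terms of the relation `IsSum`. -/
structure IsAdditive' (b : Bundle C) : Prop where
  zero_q : b.zero ≫ b.q = 𝟙 b.base
  sum_q : b.sum ≫ b.q = b.nbase 2
  add_assoc : ∃ u v w, b.IsSum (b.π 3 0) (b.π 3 1) u ∧ b.IsSum u (b.π 3 2) w ∧
    b.IsSum (b.π 3 1) (b.π 3 2) v ∧ b.IsSum (b.π 3 0) v w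
  zero_add : b.IsSum (b.q ≫ b.zero) (𝟙 b.total) (𝟙 b.total)
  add_comm : b.IsSum (b.π 2 1) (b.π 2 0) b.sum

lemma IsAdditive.isAdditive' {b : Bundle C} (h : b.IsAdditive) : b.IsAdditive' where
  zero_q := h.zero_q
  sum_q := h.sum_q
  add_assoc := ⟨_, _, _, isSum_add (h.isNFoldPullback 2) _ _ (by rw [b.π_q, b.π_q]),
    isSum_add (h.isNFoldPullback 2) _ _ (by rw [add_q _ h.sum_q, b.π_q, b.π_q]),
    isSum_add (h.isNFoldPullback 2) _ _ (by rw [b.π_q, b.π_q]),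
    (isSum_iff (h.isNFoldPullback 2) (by rw [add_q _ h.sum_q, b.π_q, b.π_q])).2 h.add_assoc.symm⟩
  zero_add := (isSum_iff (h.isNFoldPullback 2) _).2 h.zero_add
  add_comm := (isSum_iff (h.isNFoldPullback 2) _).2 h.add_comm

lemma IsAdditive'.isAdditive {b : Bundle C} (h : b.IsAdditive') (hb : ∀ n, b.IsNFoldPullback n) :
    b.IsAdditive where
  isNFoldPullback := hb
  zero_q := h.zero_q
  sum_q := h.sum_q
  add_assoc := by
    obtain ⟨u, v, w, h₁, h₂, h₃, h₄⟩ := h.add_assoc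
    have e₁ := (isSum_iff (hb 2) (by rw [b.π_q, b.π_q])).1 h₁
    have e₃ := (isSum_iff (hb 2) (by rw [b.π_q, b.π_q])).1 h₃
    subst e₁ e₃
    rw [(isSum_iff (hb 2) _).1 h₂, (isSum_iff (hb 2) _).1 h₄]
  zero_add := (isSum_iff (hb 2) _).1 h.zero_add
  add_comm := (isSum_iff (hb 2) _).1 h.add_comm

lemma IsAdditive'.map {b : Bundle C} (h : b.IsAdditive') (F : C ⥤ D) :
    (b.map F).IsAdditive' where
  zero_q := (F.map_comp _ _).symm.trans ((congrArg F.map h.zero_q).trans (F.map_id _))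
  sum_q := (F.map_comp _ _).symm.trans (congrArg F.map h.sum_q)
  add_assoc := by
    obtain ⟨u, v, w, h₁, h₂, h₃, h₄⟩ := h.add_assoc
    exact ⟨_, _, _, h₁.map F, h₂.map F, h₃.map F, h₄.map F⟩
  zero_add := by
    have := h.zero_add.map F
    rwa [F.map_id, F.map_comp] at this
  add_comm := h.add_comm.map F

lemma IsSum.of_iso {b b' : Bundle C} (e : Iso b b') {Z Z' : C} (f : Z' ≅ Z)
    {x y w : Z ⟶ b.total} {x' y' w' : Z' ⟶ b'.total} (h : b'.IsSum x' y' w')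
    (hx : f.hom ≫ x ≫ e.total.hom = x') (hy : f.hom ≫ y ≫ e.total.hom = y')
    (hw : f.hom ≫ w ≫ e.total.hom = w') : b.IsSum x y w := by
  have := (h.of_isHom e.symm.isHom).comp f.inv
  subst hx hy hw
  simpa using this

lemma IsAdditive'.of_iso {b b' : Bundle C} (e : Iso b b') (h : b.IsAdditive') :
    b'.IsAdditive' where
  zero_q := by
    have := e.zero
    rw [← cancel_epi e.base.hom, reassoc_of% this, e.q, reassoc_of% h.zero_q, Category.comp_id]
  sum_q := by
    rw [← cancel_epi (e.nfold 2).hom, reassoc_of% e.sum, e.q, reassoc_of% h.sum_q, e.nbase]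
  add_assoc := by
    obtain ⟨u, v, w, h₁, h₂, h₃, h₄⟩ := h.add_assoc
    refine ⟨(e.nfold 3).inv ≫ u ≫ e.total.hom, (e.nfold 3).inv ≫ v ≫ e.total.hom,
      (e.nfold 3).inv ≫ w ≫ e.total.hom, ?_, ?_, ?_, ?_⟩
    · exact h₁.of_iso e.symm (e.nfold 3) (by simp [reassoc_of% e.π]) (by simp [reassoc_of% e.π])
        (by simp)
    · exact h₂.of_iso e.symm (e.nfold 3) (by simp) (by simp [reassoc_of% e.π]) (by simp)
    · exact h₃.of_iso e.symm (e.nfold 3) (by simp [reassoc_of% e.π]) (by simp [reassoc_of% e.π])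
        (by simp)
    · exact h₄.of_iso e.symm (e.nfold 3) (by simp [reassoc_of% e.π]) (by simp) (by simp)
  zero_add := h.zero_add.of_iso e.symm e.total
    (by have := e.symm.zero
        simp only [Iso.symm_base, Iso.symm_total, CategoryTheory.Iso.symm_hom] at this
        simp only [Iso.symm_total, CategoryTheory.Iso.symm_hom, Category.assoc]
        rw [← this, reassoc_of% e.q, CategoryTheory.Iso.hom_inv_id_assoc]) (by simp) (by simp)
  add_comm := h.add_comm.of_iso e.symm (e.nfold 2) (by simp [reassoc_of% e.π])
    (by simp [reassoc_of% e.π]) (by simp [reassoc_of% e.sum])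

section Reflect

variable (G : C ⥤ D) [G.Faithful]

/-- The sum of `x` and `y` exists in `C` by `hb`, its image is a sum of the images, and sums in `D`
are unique by `hb'`; faithfulness identifies it with `w`. -/
lemma IsSum.of_map {b : Bundle C} (hb : b.IsNFoldPullback 2) (hb' : (b.map G).IsNFoldPullback 2)
    {Z : C} {x y w : Z ⟶ b.total} (hq : x ≫ b.q = y ≫ b.q)
    (h : (b.map G).IsSum (G.map x) (G.map y) (G.map w)) : b.IsSum x y w :=
  (isSum_iff hb hq).2 (G.map_injective (((isSum_add hb x y hq).map G).unique hb' h))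

lemma IsAdditive'.of_map {b : Bundle C} (hb : b.IsNFoldPullback 2)
    (hb' : (b.map G).IsNFoldPullback 2) (h : (b.map G).IsAdditive') : b.IsAdditive' := by
  have zero_q : b.zero ≫ b.q = 𝟙 b.base :=
    G.map_injective (by rw [G.map_comp, G.map_id]; exact h.zero_q)
  have sum_q : b.sum ≫ b.q = b.nbase 2 :=
    G.map_injective (by rw [G.map_comp]; exact h.sum_q)
  refine ⟨zero_q, sum_q, ?_, ?_, ?_⟩
  · have a₁ := isSum_add hb (b.π 3 0) (b.π 3 1) (by rw [b.π_q, b.π_q])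
    have a₃ := isSum_add hb (b.π 3 1) (b.π 3 2) (by rw [b.π_q, b.π_q])
    have a₂ := isSum_add hb _ (b.π 3 2) (by rw [add_q hb sum_q (b.π 3 0) (b.π 3 1)
      (by rw [b.π_q, b.π_q]), b.π_q, b.π_q])
    refine ⟨_, _, _, a₁, a₂, a₃, IsSum.of_map G hb hb' ?_ ?_⟩
    · rw [add_q _ sum_q, b.π_q, b.π_q]
    · obtain ⟨u, v, w, h₁, h₂, h₃, h₄⟩ := h.add_assoc
      obtain rfl := (a₁.map G).unique hb' h₁
      obtain rfl := (a₃.map G).unique hb' h₃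
      obtain rfl := (a₂.map G).unique hb' h₂
      exact h₄
  · refine IsSum.of_map G hb hb' ?_ ?_
    · rw [Category.assoc, zero_q, Category.comp_id, Category.id_comp]
    · rw [G.map_id, G.map_comp]
      exact h.zero_add
  · exact IsSum.of_map G hb hb' (by rw [b.π_q, b.π_q]) h.add_comm

lemma IsHom.of_map {b b' : Bundle C} (hb : b'.IsNFoldPullback 2)
    (hb' : (b'.map G).IsNFoldPullback 2) {f : b.base ⟶ b'.base} {g : b.total ⟶ b'.total}
    (h : IsHom (b.map G) (b'.map G) (G.map f) (G.map g)) : IsHom b b' f g := by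
  have hq : g ≫ b'.q = b.q ≫ f :=
    G.map_injective (by rw [G.map_comp, G.map_comp]; exact h.comp_q)
  refine (isHom_iff f g).2 ⟨hq, ?_, IsSum.of_map G hb hb' ?_ ?_⟩
  · exact G.map_injective (by rw [G.map_comp, G.map_comp]; exact h.zero_comp)
  · rw [Category.assoc, Category.assoc, hq, ← Category.assoc, ← Category.assoc, b.π_q, b.π_q]
  · have := ((isHom_iff _ _).1 h).2.2
    rw [G.map_comp, G.map_comp, G.map_comp]
    exact this

end Reflect

end Bundle

lemma Bundle.IsHom.of_iso_map {C : Type u₁} [Category.{v₁} C] {D : Type u₂} [Category.{v₂} D]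
    (G : C ⥤ D) [G.Faithful] {b b' : Bundle C} {d d' : Bundle D} (e : Bundle.Iso (b.map G) d)
    (e' : Bundle.Iso (b'.map G) d') (hb : b'.IsNFoldPullback 2) (hd : d'.IsNFoldPullback 2)
    {f : b.base ⟶ b'.base} {g : b.total ⟶ b'.total} {f' : d.base ⟶ d'.base}
    {g' : d.total ⟶ d'.total} (h : IsHom d d' f' g') (hf : G.map f ≫ e'.base.hom = e.base.hom ≫ f')
    (hg : G.map g ≫ e'.total.hom = e.total.hom ≫ g') : IsHom b b' f g := by
  refine IsHom.of_map G hb (hd.of_iso e'.symm) (((e.isHom.comp h).comp e'.symm.isHom).congr ?_ ?_)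
  · exact ((CategoryTheory.Iso.eq_comp_inv _).2 hf).symm
  · exact ((CategoryTheory.Iso.eq_comp_inv _).2 hg).symm

section

variable {K : Type u} [Bicategory.{w, v} K]

/-! ### 2-morphisms lying over 2-morphisms -/

section Over

variable {I X : K} {V : I ⟶ X}

/-- `φ` lies over `ψ` along `V`. -/
def Over {A A' : I ⟶ I} {B B' : X ⟶ X} (a : A ≫ V ⟶ V ≫ B) (a' : A' ≫ V ⟶ V ≫ B')
    (φ : A ⟶ A') (ψ : B ⟶ B') : Prop :=
  φ ▷ V ≫ a' = a ≫ V ◁ ψ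

/-- The composite of two squares. -/
def lawSq {A A' : I ⟶ I} {B B' : X ⟶ X} (a : A ≫ V ⟶ V ≫ B) (a' : A' ≫ V ⟶ V ≫ B') :
    (A ≫ A') ≫ V ⟶ V ≫ B ≫ B' :=
  (α_ A A' V).hom ≫ A ◁ a' ≫ (α_ A V B').inv ≫ a ▷ B' ≫ (α_ V B B').hom

instance {A A' : I ⟶ I} {B B' : X ⟶ X} (a : A ≫ V ⟶ V ≫ B) (a' : A' ≫ V ⟶ V ≫ B')
    [IsIso a] [IsIso a'] : IsIso (lawSq a a') := by
  unfold lawSq; infer_instance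

variable {A A' A'' C C' : I ⟶ I} {B B' B'' D D' : X ⟶ X} {a : A ≫ V ⟶ V ≫ B}
  {a' : A' ≫ V ⟶ V ≫ B'} {a'' : A'' ≫ V ⟶ V ≫ B''} (b : C ≫ V ⟶ V ≫ D) {b' : C' ≫ V ⟶ V ≫ D'}

lemma Over.comp {φ : A ⟶ A'} {ψ : B ⟶ B'} {φ' : A' ⟶ A''} {ψ' : B' ⟶ B''} (h : Over a a' φ ψ)
    (h' : Over a' a'' φ' ψ') : Over a a'' (φ ≫ φ') (ψ ≫ ψ') := by
  unfold Over at *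
  rw [comp_whiskerRight, Category.assoc, h', reassoc_of% h, whiskerLeft_comp]

lemma Over.id (a : A ≫ V ⟶ V ≫ B) : Over a a (𝟙 A) (𝟙 B) := by simp [Over]

lemma Over.whiskerRight {φ : A ⟶ A'} {ψ : B ⟶ B'} (h : Over a a' φ ψ) :
    Over (lawSq a b) (lawSq a' b) (φ ▷ C) (ψ ▷ D) := by
  unfold Over lawSq at *
  calc _ = 𝟙 _ ⊗≫ (φ ▷ (C ≫ V) ≫ A' ◁ b) ⊗≫ a' ▷ D ⊗≫ 𝟙 _ := by bicategory
    _ = 𝟙 _ ⊗≫ A ◁ b ⊗≫ (φ ▷ V ≫ a') ▷ D ⊗≫ 𝟙 _ := by rw [← whisker_exchange]; bicategory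
    _ = _ := by rw [h]; bicategory

lemma Over.whiskerLeft {φ : A ⟶ A'} {ψ : B ⟶ B'} (h : Over a a' φ ψ) :
    Over (lawSq b a) (lawSq b a') (C ◁ φ) (D ◁ ψ) := by
  unfold Over lawSq at *
  calc _ = 𝟙 _ ⊗≫ C ◁ (φ ▷ V ≫ a') ⊗≫ b ▷ B' ⊗≫ 𝟙 _ := by bicategory
    _ = 𝟙 _ ⊗≫ C ◁ a ⊗≫ ((C ≫ V) ◁ ψ ≫ b ▷ B') ⊗≫ 𝟙 _ := by rw [h]; bicategory
    _ = _ := by rw [whisker_exchange]; bicategory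

lemma Over.associator (a : A ≫ V ⟶ V ≫ B) (a' : A' ≫ V ⟶ V ≫ B') (a'' : A'' ≫ V ⟶ V ≫ B'') :
    Over (lawSq (lawSq a a') a'') (lawSq a (lawSq a' a'')) (α_ A A' A'').hom
      (α_ B B' B'').hom := by
  unfold Over lawSq
  bicategory

lemma Over.associator_inv (a : A ≫ V ⟶ V ≫ B) (a' : A' ≫ V ⟶ V ≫ B') (a'' : A'' ≫ V ⟶ V ≫ B'') :
    Over (lawSq a (lawSq a' a'')) (lawSq (lawSq a a') a'') (α_ A A' A'').inv
      (α_ B B' B'').inv := by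
  unfold Over lawSq
  bicategory

lemma Over.leftUnitor_inv (a : A ≫ V ⟶ V ≫ B) :
    Over a (lawSq ((λ_ V).hom ≫ (ρ_ V).inv) a) (λ_ A).inv (λ_ B).inv := by
  unfold Over lawSq
  bicategory

lemma Over.rightUnitor_inv (a : A ≫ V ⟶ V ≫ B) :
    Over a (lawSq a ((λ_ V).hom ≫ (ρ_ V).inv)) (ρ_ A).inv (ρ_ B).inv := by
  unfold Over lawSq
  bicategory

lemma Over.leftUnitor_hom (a : A ≫ V ⟶ V ≫ B) :
    Over (lawSq ((λ_ V).hom ≫ (ρ_ V).inv) a) a (λ_ A).hom (λ_ B).hom := by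
  unfold Over lawSq
  bicategory

/-- The square obtained by precomposition with `F`. -/
def pastePre {Y : K} (F : Y ⟶ I) (a : A ≫ V ⟶ V ≫ B) : (F ≫ A) ≫ V ⟶ (F ≫ V) ≫ B :=
  (α_ F A V).hom ≫ F ◁ a ≫ (α_ F V B).inv

instance {Y : K} (F : Y ⟶ I) (a : A ≫ V ⟶ V ≫ B) [IsIso a] : IsIso (pastePre F a) := by
  unfold pastePre; infer_instance

lemma Over.pastePre {Y : K} (F : Y ⟶ I) {φ : A ⟶ A'} {ψ : B ⟶ B'} (h : Over a a' φ ψ) :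
    (F ◁ φ) ▷ V ≫ Tng.pastePre F a' = Tng.pastePre F a ≫ (F ≫ V) ◁ ψ := by
  unfold Over at h
  unfold Tng.pastePre
  calc _ = 𝟙 _ ⊗≫ F ◁ (φ ▷ V ≫ a') ⊗≫ 𝟙 _ := by bicategory
    _ = _ := by rw [h]; bicategory

end Over

/-! ### 1-morphisms reflecting limits -/

/-- Whiskering with `V` is faithful, and a 2-morphism `m : V ∘ Z ⇒ V ∘ P` lifts to `Z ⇒ P` as soon
as its composites with some family of 2-morphisms `V fᵢ` lift, where the `T V fᵢ` are jointly
monic. -/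
structure Reflects {I X : K} (V : I ⟶ X) (T : X ⟶ X) : Prop where
  faithful : ∀ {Y : K} {H H' : Y ⟶ I} {φ ψ : H ⟶ H'}, φ ▷ V = ψ ▷ V → φ = ψ
  exists_lift : ∀ {Y : K} {Z P : Y ⟶ I} (m : Z ≫ V ⟶ P ≫ V) {ι : Type} {B : ι → (Y ⟶ I)}
    (f : ∀ i, P ⟶ B i) (x : ∀ i, Z ⟶ B i), (∀ i, m ≫ f i ▷ V = x i ▷ V) →
    (∀ {Q : Y ⟶ X} (a b : Q ⟶ (P ≫ V) ≫ T),
      (∀ i, a ≫ f i ▷ V ▷ T = b ≫ f i ▷ V ▷ T) → a = b) →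
    ∃ m' : Z ⟶ P, m' ▷ V = m

namespace Reflects

variable {I X : K} {V : I ⟶ X} {T : X ⟶ X} (hV : Reflects V T)
include hV

lemma faithful_postcomp (Y : K) : (postcomp Y V).Faithful := ⟨hV.faithful⟩

/-- The equational axioms for `l` and `c` on `I` all come from here: the two sides lie over the two
sides of the same axiom on `X`. -/
lemma over_unique {A A' : I ⟶ I} {B B' : X ⟶ X} {a : A ≫ V ⟶ V ≫ B} {a' : A' ≫ V ⟶ V ≫ B'}
    [IsIso a'] {φ φ' : A ⟶ A'} {ψ : B ⟶ B'} (h : Over a a' φ ψ) (h' : Over a a' φ' ψ) :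
    φ = φ' :=
  hV.faithful (by rw [← cancel_mono a']; exact h.trans h'.symm)

/-- The comparison map exists along `V` by `h`. It lifts because its composites with the projections
do, and `h'` makes the `T`-images of the projections jointly monic. -/
lemma isNFoldPullback {Y : K} {b : Bundle (Y ⟶ I)} {n : ℕ}
    (h : (b.map (postcomp Y V)).IsNFoldPullback n)
    (h' : ((b.map (postcomp Y V)).map (postcomp Y T)).IsNFoldPullback n) :
    b.IsNFoldPullback n := by
  rw [Bundle.isNFoldPullback_iff]
  intro Z y x hx
  obtain ⟨m, h₁, h₂⟩ := h.exists_lift (y ▷ V) (fun i => x i ▷ V)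
    (fun i => by rw [← hx i, comp_whiskerRight]; rfl)
  -- The index `none` is the projection to the base, needed when `n = 0`.
  obtain ⟨m', rfl⟩ := hV.exists_lift m (ι := Option (Fin n))
    (B := fun i => i.elim b.base fun _ => b.total)
    (fun i => match i with
      | none => b.nbase n
      | some i => b.π n i)
    (fun i => match i with
      | none => y
      | some i => x i)
    (fun i => match i with
      | none => h₁
      | some i => h₂ i)
    (fun f g hfg => h'.hom_ext (hfg none) (fun i => hfg (some i)))
  refine ⟨m', ⟨hV.faithful ?_, fun i => hV.faithful ?_⟩, ?_⟩
  · rw [comp_whiskerRight]; exact h₁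
  · rw [comp_whiskerRight]; exact h₂ i
  · rintro k ⟨rfl, h₄⟩
    refine hV.faithful (h.hom_ext ?_ fun i => ?_)
    · exact (comp_whiskerRight _ _ _).symm.trans h₁.symm
    · exact (comp_whiskerRight _ _ _).symm.trans ((congrArg (· ▷ V) (h₄ i)).trans (h₂ i).symm)

/-- Only joint monicity of the two legs after `T` is required, not that `T` preserves the pullback;
this weaker condition is what the vertical lift satisfies. -/
lemma isPullback {Y : K} {P A B C : Y ⟶ I} {f : P ⟶ A} {g : P ⟶ B} {h : A ⟶ C} {k : B ⟶ C}
    (sq : IsPullback (f ▷ V) (g ▷ V) (h ▷ V) (k ▷ V))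
    (hT : ∀ {Q : Y ⟶ X} (a b : Q ⟶ (P ≫ V) ≫ T), a ≫ f ▷ V ▷ T = b ≫ f ▷ V ▷ T →
      a ≫ g ▷ V ▷ T = b ≫ g ▷ V ▷ T → a = b) : IsPullback f g h k := by
  have w : f ≫ h = g ≫ k := hV.faithful (by rw [comp_whiskerRight, sq.w, comp_whiskerRight])
  refine ⟨⟨w⟩, ⟨PullbackCone.isLimitAux' _ fun s => Classical.choice ?_⟩⟩
  have hs : s.fst ▷ V ≫ h ▷ V = s.snd ▷ V ≫ k ▷ V := by
    rw [← comp_whiskerRight, s.condition, comp_whiskerRight]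
  have key := hV.exists_lift (sq.lift _ _ hs) (ι := Bool) (B := fun i => cond i A B)
    (fun i => match i with
      | true => f
      | false => g)
    (fun i => match i with
      | true => s.fst
      | false => s.snd)
    (fun i => match i with
      | true => sq.lift_fst _ _ hs
      | false => sq.lift_snd _ _ hs)
    (fun a b hab => hT a b (hab true) (hab false))
  obtain ⟨m, hm⟩ := key
  have hf : m ≫ f = s.fst := hV.faithful (by rw [comp_whiskerRight, hm, sq.lift_fst])
  have hg : m ≫ g = s.snd := hV.faithful (by rw [comp_whiskerRight, hm, sq.lift_snd])
  have hu : ∀ m' : s.pt ⟶ P, m' ≫ f = s.fst → m' ≫ g = s.snd → m' = m := fun m' h₁ h₂ =>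
    hV.faithful (sq.hom_ext
      (by rw [← comp_whiskerRight, ← comp_whiskerRight, h₁, hf])
      (by rw [← comp_whiskerRight, ← comp_whiskerRight, h₂, hg]))
  exact ⟨⟨m, hf, hg, fun {m'} h₁ h₂ => hu m' h₁ h₂⟩⟩

end Reflects

/-! ### Pointwise pullbacks of a tangent structure -/

/-- The `n`-fold pullbacks of the projection are pointwise and preserved by all iterates of `T`. -/
def TangentData.HasNFold {X : K} (t : TangentData X) : Prop :=
  ∀ (n m : ℕ) {Y : K} (F : Y ⟶ X),
    ((t.bundle.map (postcomp X (iter t.T m))).map (precomp X F)).IsNFoldPullback n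

namespace TangentData.HasNFold

variable {X : K} {t : TangentData X} (ht : t.HasNFold)
include ht

lemma precomp {Y : K} (F : Y ⟶ X) (n : ℕ) : (t.bundle.map (precomp X F)).IsNFoldPullback n :=
  (ht n 0 F).of_iso ((Bundle.Iso.ofNatIso t.bundle (rightUnitorNatIso X X)).map _)

lemma bundle (n : ℕ) : t.bundle.IsNFoldPullback n :=
  (ht.precomp (𝟙 X) n).of_iso (Bundle.Iso.ofNatIso t.bundle (leftUnitorNatIso X X))

/-- `iter t.T 1` is `𝟙 X ≫ t.T`, so a unitor separates it from `t.T`. -/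
lemma postcomp_precomp {Y : K} (F : Y ⟶ X) (n : ℕ) :
    ((t.bundle.map (postcomp X t.T)).map (Bicategory.precomp X F)).IsNFoldPullback n :=
  (ht n 1 F).of_iso ((Bundle.Iso.ofNatIso t.bundle
    ((postcomposing X X X).mapIso (λ_ t.T))).map _)

lemma postcomp (n : ℕ) : (t.bundle.map (postcomp X t.T)).IsNFoldPullback n :=
  (ht.postcomp_precomp (𝟙 X) n).of_iso (Bundle.Iso.ofNatIso _ (leftUnitorNatIso X X))

end TangentData.HasNFold

lemma TangentStructure.hasNFold {X : K} (t : TangentStructure X) : t.HasNFold :=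
  t.isNFoldPullback


/-! ### The flip on `T₂` and the image under `T` of the universality square. -/

namespace TangentStructure

variable {X : K} (t : TangentStructure X)

lemma flip_comp_p : t.c ≫ t.T ◁ t.p = t.p ▷ t.T ≫ (λ_ t.T).hom ≫ (ρ_ t.T).inv :=
  t.flip_isHom.comp_q

lemma z_comp_flip : t.z ▷ t.T ≫ t.c = ((λ_ t.T).hom ≫ (ρ_ t.T).inv) ≫ t.T ◁ t.z :=
  t.flip_isHom.zero_comp

lemma lift_law₂ : t.l ▷ t.T ≫ law₂ t.c = t.c ≫ t.T ◁ t.l :=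
  (LaxHom.isLax (A := ⟨X, t⟩) (B := ⟨X, t⟩) (tangentHom ⟨X, t⟩)).lift

/-- The flip identifies `T T₂` with `(T₂)_T`, compatibly with `T ν` and `ν_T`, where `ν` is the
upper side `Ts ∘ (z_T × l)` of the universality square. -/
lemma exists_flip_nfold {k : t.Tn 2 ⟶ t.Tn 2 ≫ t.T}
    (hk₀ : k ≫ t.π 2 0 ▷ t.T = t.π 2 0 ≫ (ρ_ t.T).inv ≫ t.T ◁ t.z)
    (hk₁ : k ≫ t.π 2 1 ▷ t.T = t.π 2 1 ≫ t.l) :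
    ∃ e : t.Tn 2 ≫ t.T ⟶ t.T ≫ t.Tn 2,
      (∀ i, e ≫ t.T ◁ t.π 2 i = t.π 2 i ▷ t.T ≫ t.c) ∧
      (k ≫ t.s ▷ t.T) ▷ t.T ≫ law₂ t.c = e ≫ t.T ◁ (k ≫ t.s ▷ t.T) := by
  -- `e` is the flip taken componentwise on `T₂`; `h₂` says that it respects sums.
  obtain ⟨e, h₁, h₂⟩ := t.flip_isHom.sum_comp
  change t.Tn 2 ≫ t.T ⟶ t.T ≫ t.Tn 2 at e
  replace h₁ : ∀ i, e ≫ t.T ◁ t.π 2 i = t.π 2 i ▷ t.T ≫ t.c := h₁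
  replace h₂ : t.s ▷ t.T ≫ t.c = e ≫ t.T ◁ t.s := h₂
  refine ⟨e, h₁, ?_⟩
  -- Compatibility of `k = z_T × l` with the flips is tested on the two projections of a pullback.
  -- Component `0` reduces to the flip exchanging `T z` with `z_T`, component `1` to compatibility
  -- of the flip with the lift.
  have key : k ▷ t.T ≫ (α_ _ _ _).hom ≫ t.Tn 2 ◁ t.c ≫ (α_ _ _ _).inv ≫ e ▷ t.T ≫
      (α_ _ _ _).hom = e ≫ t.T ◁ k := by
    have gen : ∀ i, (k ▷ t.T ≫ (α_ _ _ _).hom ≫ t.Tn 2 ◁ t.c ≫ (α_ _ _ _).inv ≫ e ▷ t.T ≫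
        (α_ _ _ _).hom) ≫ t.T ◁ t.π 2 i ▷ t.T = (k ≫ t.π 2 i ▷ t.T) ▷ t.T ≫ law₂ t.c := by
      intro i
      calc _ = k ▷ t.T ⊗≫ t.Tn 2 ◁ t.c ⊗≫ (e ≫ t.T ◁ t.π 2 i) ▷ t.T ⊗≫ 𝟙 _ := by bicategory
        _ = k ▷ t.T ⊗≫ (t.Tn 2 ◁ t.c ≫ t.π 2 i ▷ (t.T ≫ t.T)) ⊗≫ t.c ▷ t.T ⊗≫ 𝟙 _ := by
          rw [h₁]; bicategory
        _ = _ := by rw [whisker_exchange, law₂]; bicategory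
    refine (t.hasNFold.postcomp_precomp t.T 2).hom_ext₂ (Fin.forall_fin_two.2 ⟨?_, ?_⟩)
    · refine (gen 0).trans ?_
      change _ = (e ≫ t.T ◁ k) ≫ t.T ◁ t.π 2 0 ▷ t.T
      rw [Category.assoc, ← Bicategory.whiskerLeft_comp, hk₀, Bicategory.whiskerLeft_comp,
        reassoc_of% h₁ 0]
      calc _ = t.π 2 0 ▷ t.T ⊗≫ t.T ◁ (t.z ▷ t.T ≫ t.c) ⊗≫ t.c ▷ t.T ⊗≫ 𝟙 _ := by
            rw [law₂]; bicategory
        _ = t.π 2 0 ▷ t.T ⊗≫ ((t.T ≫ t.T) ◁ t.z ≫ t.c ▷ t.T) ⊗≫ 𝟙 _ := by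
            rw [z_comp_flip]; bicategory
        _ = _ := by rw [whisker_exchange]; bicategory
    · refine (gen 1).trans ?_
      change _ = (e ≫ t.T ◁ k) ≫ t.T ◁ t.π 2 1 ▷ t.T
      rw [Category.assoc, ← Bicategory.whiskerLeft_comp, hk₁, Bicategory.whiskerLeft_comp,
        reassoc_of% h₁ 1, comp_whiskerRight, Category.assoc, lift_law₂]
  calc _ = k ▷ t.T ⊗≫ (t.s ▷ (t.T ≫ t.T) ≫ t.T ◁ t.c) ⊗≫ t.c ▷ t.T ⊗≫ 𝟙 _ := by
        rw [law₂]; bicategory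
    _ = k ▷ t.T ⊗≫ t.Tn 2 ◁ t.c ⊗≫ (t.s ▷ t.T ≫ t.c) ▷ t.T ⊗≫ 𝟙 _ := by
        rw [← whisker_exchange]; bicategory
    _ = (k ▷ t.T ≫ (α_ _ _ _).hom ≫ t.Tn 2 ◁ t.c ≫ (α_ _ _ _).inv ≫ e ▷ t.T ≫
          (α_ _ _ _).hom) ≫ t.T ◁ t.s ▷ t.T := by rw [h₂]; bicategory
    _ = _ := by rw [key, Category.assoc, ← Bicategory.whiskerLeft_comp]

/-- The universality square of the vertical lift is sent by `T` to a jointly monic pair. -/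
lemma lift_jointly_monic {k : t.Tn 2 ⟶ t.Tn 2 ≫ t.T}
    (hk₀ : k ≫ t.π 2 0 ▷ t.T = t.π 2 0 ≫ (ρ_ t.T).inv ≫ t.T ◁ t.z)
    (hk₁ : k ≫ t.π 2 1 ▷ t.T = t.π 2 1 ≫ t.l)
    (hk : ∀ {Y : K} (F : Y ⟶ X), IsPullback (F ◁ (k ≫ t.s ▷ t.T)) (F ◁ t.pn 2) (F ◁ (t.p ▷ t.T))
      (F ◁ (t.z ≫ (λ_ t.T).inv)))
    {Y : K} {F Q : Y ⟶ X} {a b : Q ⟶ (F ≫ t.Tn 2) ≫ t.T}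
    (h₁ : a ≫ (F ◁ (k ≫ t.s ▷ t.T)) ▷ t.T = b ≫ (F ◁ (k ≫ t.s ▷ t.T)) ▷ t.T)
    (h₂ : a ≫ (F ◁ t.pn 2) ▷ t.T = b ≫ (F ◁ t.pn 2) ▷ t.T) : a = b := by
  obtain ⟨e, he, hν⟩ := t.exists_flip_nfold hk₀ hk₁
  have hep : e ≫ t.T ◁ t.pn 2 = t.pn 2 ▷ t.T ≫ (λ_ t.T).hom ≫ (ρ_ t.T).inv := by
    rw [← t.π_p 2 0, Bicategory.whiskerLeft_comp, reassoc_of% he 0, flip_comp_p,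
      comp_whiskerRight, Category.assoc]
  -- Composing with `e` replaces `T` of the square at `F` by the square at `F ≫ T`, which is a
  -- pullback by pointwiseness.
  have hab : a ≫ (α_ _ _ _).hom ≫ F ◁ e ≫ (α_ _ _ _).inv =
      b ≫ (α_ _ _ _).hom ≫ F ◁ e ≫ (α_ _ _ _).inv := by
    refine (hk (F ≫ t.T)).hom_ext ?_ ?_
    · have e₁ : ((α_ _ _ _).hom ≫ F ◁ e ≫ (α_ _ _ _).inv) ≫ (F ≫ t.T) ◁ (k ≫ t.s ▷ t.T) =
          (F ◁ (k ≫ t.s ▷ t.T)) ▷ t.T ≫ (α_ _ _ _).hom ≫ F ◁ law₂ t.c ≫ (α_ _ _ _).inv := by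
        calc _ = 𝟙 _ ⊗≫ F ◁ (e ≫ t.T ◁ (k ≫ t.s ▷ t.T)) ⊗≫ 𝟙 _ := by bicategory
          _ = _ := by rw [← hν]; bicategory
      simp only [Category.assoc] at e₁ ⊢
      rw [e₁, reassoc_of% h₁]
    · have e₂ : ((α_ _ _ _).hom ≫ F ◁ e ≫ (α_ _ _ _).inv) ≫ (F ≫ t.T) ◁ t.pn 2 =
          (F ◁ t.pn 2) ▷ t.T ≫ (α_ _ _ _).hom ≫ F ◁ ((λ_ t.T).hom ≫ (ρ_ t.T).inv) ≫
            (α_ _ _ _).inv := by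
        calc _ = 𝟙 _ ⊗≫ F ◁ (e ≫ t.T ◁ t.pn 2) ⊗≫ 𝟙 _ := by bicategory
          _ = _ := by rw [hep]; bicategory
      simp only [Category.assoc] at e₂ ⊢
      rw [e₂, reassoc_of% h₂]
  rw [← cancel_mono (α_ _ _ _).hom]
  refine (t.hasNFold.postcomp_precomp F 2).hom_ext₂ fun i => ?_
  change (a ≫ (α_ _ _ _).hom) ≫ F ◁ t.π 2 i ▷ t.T = (b ≫ (α_ _ _ _).hom) ≫ F ◁ t.π 2 i ▷ t.T
  -- There is no need to invert `e`: since `c² = id`, the projections of `T ∘ T₂` factor through it,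
  -- and these are jointly monic.
  have e₃ : ((α_ F (t.Tn 2) t.T).hom ≫ F ◁ e ≫ (α_ _ _ _).inv) ≫
      (α_ _ _ _).hom ≫ F ◁ t.T ◁ t.π 2 i ≫ F ◁ t.c =
        (α_ _ _ _).hom ≫ F ◁ t.π 2 i ▷ t.T := by
    simp only [Category.assoc, Iso.inv_hom_id_assoc, ← Bicategory.whiskerLeft_comp]
    rw [reassoc_of% he i, t.flip_flip, Category.comp_id]
  rw [Category.assoc, Category.assoc, ← e₃]
  simpa only [Category.assoc] using
    congrArg (· ≫ (α_ _ _ _).hom ≫ F ◁ t.T ◁ t.π 2 i ≫ F ◁ t.c) hab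

end TangentStructure


/-! ### Tangent structures lying over a given one along a reflecting 1-morphism. -/

/-- The comparison of identities. -/
abbrev idSq {I X : K} (V : I ⟶ X) : 𝟙 I ≫ V ⟶ V ≫ 𝟙 X := (λ_ V).hom ≫ (ρ_ V).inv

/-- The composite of two invertible squares. -/
noncomputable def lawSqIso {I X : K} {V : I ⟶ X} {A A' : I ⟶ I} {B B' : X ⟶ X}
    (a : A ≫ V ≅ V ≫ B) (a' : A' ≫ V ≅ V ≫ B') : (A ≫ A') ≫ V ≅ V ≫ B ≫ B' :=
  asIso (lawSq a.hom a'.hom)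

/-- The data of a tangent structure on `I` lying over the tangent structure of `X` along the
1-morphism `V`. -/
structure TangentLift (X : Tangentad K) {I : K} (V : I ⟶ X.obj) where
  data : TangentData I
  /-- the comparison of the tangent bundle 1-morphisms -/
  law : data.T ≫ V ≅ V ≫ X.str.T
  /-- the comparison of the pullbacks `T_n` -/
  lawn : ∀ n, data.Tn n ≫ V ≅ V ≫ X.str.Tn n
  over_p : Over law.hom (idSq V) data.p X.str.p
  over_z : Over (idSq V) law.hom data.z X.str.z
  over_pn : ∀ n, Over (lawn n).hom (idSq V) (data.pn n) (X.str.pn n)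
  over_π : ∀ n i, Over (lawn n).hom law.hom (data.π n i) (X.str.π n i)
  over_s : Over (lawn 2).hom law.hom data.s X.str.s
  lift : Over law.hom (lawSq law.hom law.hom) data.l X.str.l
  flip : Over (lawSq law.hom law.hom) (lawSq law.hom law.hom) data.c X.str.c

namespace TangentLift

variable {X : Tangentad K} {I : K} {V : I ⟶ X.obj} (L : TangentLift X V)

/-- The comparison of bundles. -/
def iso : Bundle.Iso (L.data.bundle.map (postcomp I V)) (X.str.bundle.map (precomp X.obj V)) where
  base := λ_ V ≪≫ (ρ_ V).symm
  total := L.law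
  nfold := L.lawn
  q := L.over_p.symm
  nbase n := (L.over_pn n).symm
  π n i := (L.over_π n i).symm
  zero := L.over_z.symm
  sum := L.over_s.symm

/-- The comparison of bundles after postcomposition with `S^I` and `S`. -/
noncomputable def isoPost {S : I ⟶ I} {S' : X.obj ⟶ X.obj} (σ : S ≫ V ≅ V ≫ S') :
    Bundle.Iso ((L.data.bundle.map (postcomp I S)).map (postcomp I V))
      ((X.str.bundle.map (postcomp X.obj S')).map (precomp X.obj V)) where
  base := lawSqIso (λ_ V ≪≫ (ρ_ V).symm) σ
  total := lawSqIso L.law σ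
  nfold n := lawSqIso (L.lawn n) σ
  q := (L.over_p.whiskerRight σ.hom).symm
  nbase n := ((L.over_pn n).whiskerRight σ.hom).symm
  π n i := ((L.over_π n i).whiskerRight σ.hom).symm
  zero := (L.over_z.whiskerRight σ.hom).symm
  sum := (L.over_s.whiskerRight σ.hom).symm

/-- The comparison of bundles after precomposition with `T^I` and `T`. -/
noncomputable def isoPre :
    Bundle.Iso ((L.data.bundle.map (precomp I L.data.T)).map (postcomp I V))
      ((X.str.bundle.map (precomp X.obj X.str.T)).map (precomp X.obj V)) where
  base := lawSqIso L.law (λ_ V ≪≫ (ρ_ V).symm)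
  total := lawSqIso L.law L.law
  nfold n := lawSqIso L.law (L.lawn n)
  q := (L.over_p.whiskerLeft L.law.hom).symm
  nbase n := ((L.over_pn n).whiskerLeft L.law.hom).symm
  π n i := ((L.over_π n i).whiskerLeft L.law.hom).symm
  zero := (L.over_z.whiskerLeft L.law.hom).symm
  sum := (L.over_s.whiskerLeft L.law.hom).symm

/-- Precomposition with `F : Y ⟶ I` of an isomorphism of bundles over `V`. -/
def isoComp {b : Bundle (I ⟶ I)} {c : Bundle (X.obj ⟶ X.obj)}
    (e : Bundle.Iso (b.map (postcomp I V)) (c.map (precomp X.obj V))) {Y : K} (F : Y ⟶ I) :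
    Bundle.Iso ((b.map (precomp I F)).map (postcomp Y V)) (c.map (precomp X.obj (F ≫ V))) :=
  ((Bundle.Iso.ofNatIso b (associatorNatIsoMiddle F V)).trans (e.map (precomp X.obj F))).trans
    (Bundle.Iso.ofNatIso c (associatorNatIsoRight F V X.obj)).symm

lemma iter_iso (m : ℕ) : Nonempty (iter L.data.T m ≫ V ≅ V ≫ iter X.str.T m) := by
  induction m with
  | zero => exact ⟨λ_ V ≪≫ (ρ_ V).symm⟩
  | succ m ih =>
    obtain ⟨e⟩ := ih
    exact ⟨lawSqIso e L.law⟩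

variable (hV : Reflects V X.str.T)
include hV

lemma hasNFold : L.data.HasNFold := by
  intro n m Y F
  obtain ⟨σ⟩ := L.iter_iso m
  have e := isoComp (L.isoPost σ) F
  refine hV.isNFoldPullback ((X.str.hasNFold n m (F ≫ V)).of_iso e.symm) ?_
  -- Applying `T` after the `m`-th iterate gives the iterate `m + 1`, where the pullback property of
  -- `X` applies again.
  refine Bundle.IsNFoldPullback.of_iso (e.map _).symm
    ((X.str.hasNFold n (m + 1) (F ≫ V)).of_iso ?_)
  exact (Bundle.Iso.ofNatIso X.str.bundle
    (NatIso.ofComponents (fun A => (α_ (F ≫ V) (A ≫ iter X.str.T m) X.str.T ≪≫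
        whiskerLeftIso (F ≫ V) (α_ A (iter X.str.T m) X.str.T)).symm) (fun f => by
          simp only [iter, postcomp, precomp, Functor.comp_obj, Functor.comp_map, Iso.symm_hom,
            Iso.trans_inv, whiskerLeftIso_inv]
          bicategory) :
      postcomp X.obj (iter X.str.T (m + 1)) ⋙ precomp X.obj (F ≫ V) ≅
        postcomp X.obj (iter X.str.T m) ⋙ precomp X.obj (F ≫ V) ⋙ postcomp Y X.str.T))

lemma isAdditive : L.data.bundle.IsAdditive := by
  have := hV.faithful_postcomp I
  refine Bundle.IsAdditive'.isAdditive ?_ (L.hasNFold hV).bundle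
  exact Bundle.IsAdditive'.of_map (postcomp I V) ((L.hasNFold hV).bundle 2)
    ((X.str.hasNFold.precomp V 2).of_iso L.iso.symm)
    ((X.str.isAdditive.isAdditive'.map _).of_iso L.iso.symm)

lemma isHom_lift : Bundle.IsHom L.data.bundle (L.data.bundle.map (postcomp I L.data.T))
    (L.data.z ≫ (λ_ L.data.T).inv) L.data.l := by
  have := hV.faithful_postcomp I
  refine Bundle.IsHom.of_iso_map (postcomp I V) L.iso (L.isoPost L.law)
    ((L.hasNFold hV).postcomp 2) (X.str.hasNFold.postcomp_precomp V 2)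
    (X.str.lift_isHom.map (precomp X.obj V)) ?_ L.lift
  exact L.over_z.comp (Over.leftUnitor_inv L.law.hom)

lemma isHom_flip : Bundle.IsHom (L.data.bundle.map (postcomp I L.data.T))
    (L.data.bundle.map (precomp I L.data.T)) ((λ_ L.data.T).hom ≫ (ρ_ L.data.T).inv)
    L.data.c := by
  have := hV.faithful_postcomp I
  refine Bundle.IsHom.of_iso_map (postcomp I V) (L.isoPost L.law) L.isoPre
    ((L.hasNFold hV).precomp L.data.T 2) ?_
    (X.str.flip_isHom.map (precomp X.obj V)) ?_ L.flip
  · exact (X.str.hasNFold.precomp (V ≫ X.str.T) 2).of_iso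
      (Bundle.Iso.ofNatIso X.str.bundle (associatorNatIsoRight V X.str.T X.obj))
  · exact (Over.leftUnitor_hom L.law.hom).comp (Over.rightUnitor_inv L.law.hom)

/-- `k'` comes from the pullback property of `T ∘ T₂` on `I`. It lies over `k` because both have the
same composites with the projections of `T ∘ T₂` restricted along `V`. -/
lemma exists_over_lift {k : X.str.Tn 2 ⟶ X.str.Tn 2 ≫ X.str.T}
    (hk₀ : k ≫ X.str.π 2 0 ▷ X.str.T = X.str.π 2 0 ≫ (ρ_ X.str.T).inv ≫ X.str.T ◁ X.str.z)
    (hk₁ : k ≫ X.str.π 2 1 ▷ X.str.T = X.str.π 2 1 ≫ X.str.l) :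
    ∃ k' : L.data.Tn 2 ⟶ L.data.Tn 2 ≫ L.data.T,
      k' ≫ L.data.π 2 0 ▷ L.data.T = L.data.π 2 0 ≫ (ρ_ L.data.T).inv ≫ L.data.T ◁ L.data.z ∧
      k' ≫ L.data.π 2 1 ▷ L.data.T = L.data.π 2 1 ≫ L.data.l ∧
      Over (L.lawn 2).hom (lawSq (L.lawn 2).hom L.law.hom) k' k := by
  have hlp : L.data.l ≫ L.data.p ▷ L.data.T =
    L.data.p ≫ L.data.z ≫ (λ_ L.data.T).inv := (L.isHom_lift hV).comp_q
  have w₀ : (L.data.π 2 0 ≫ (ρ_ L.data.T).inv ≫ L.data.T ◁ L.data.z) ≫ L.data.p ▷ L.data.T =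
      L.data.pn 2 ≫ L.data.z ≫ (λ_ L.data.T).inv := by
    rw [Category.assoc, Category.assoc, whisker_exchange, ← L.data.π_p 2 0]
    simp
  have w₁ : (L.data.π 2 1 ≫ L.data.l) ≫ L.data.p ▷ L.data.T =
      L.data.pn 2 ≫ L.data.z ≫ (λ_ L.data.T).inv := by
    rw [Category.assoc, hlp, ← L.data.π_p 2 1, Category.assoc]
  obtain ⟨k', -, hk'⟩ := ((L.hasNFold hV).postcomp 2).exists_lift
    (L.data.pn 2 ≫ L.data.z ≫ (λ_ L.data.T).inv)
    ![L.data.π 2 0 ≫ (ρ_ L.data.T).inv ≫ L.data.T ◁ L.data.z, L.data.π 2 1 ≫ L.data.l]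
    (Fin.forall_fin_two.2 ⟨w₀, w₁⟩)
  change L.data.Tn 2 ⟶ L.data.Tn 2 ≫ L.data.T at k'
  have h₀ : k' ≫ L.data.π 2 0 ▷ L.data.T =
    L.data.π 2 0 ≫ (ρ_ L.data.T).inv ≫ L.data.T ◁ L.data.z := hk' 0
  have h₁ : k' ≫ L.data.π 2 1 ▷ L.data.T = L.data.π 2 1 ≫ L.data.l := hk' 1
  refine ⟨k', h₀, h₁, ?_⟩
  have o (i : Fin 2) := (L.over_π 2 i).whiskerRight L.law.hom
  refine (X.str.hasNFold.postcomp_precomp V 2).hom_ext₂ (Fin.forall_fin_two.2 ⟨?_, ?_⟩)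
  · change (k' ▷ V ≫ lawSq (L.lawn 2).hom L.law.hom) ≫ V ◁ X.str.π 2 0 ▷ X.str.T =
      ((L.lawn 2).hom ≫ V ◁ k) ≫ V ◁ X.str.π 2 0 ▷ X.str.T
    have := (L.over_π 2 0).comp ((Over.rightUnitor_inv L.law.hom).comp
      (L.over_z.whiskerLeft L.law.hom))
    rw [← h₀, ← hk₀] at this
    unfold Over at this o
    rw [Category.assoc, ← o 0, ← comp_whiskerRight_assoc, this, Category.assoc,
      Bicategory.whiskerLeft_comp]
  · change (k' ▷ V ≫ lawSq (L.lawn 2).hom L.law.hom) ≫ V ◁ X.str.π 2 1 ▷ X.str.T =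
      ((L.lawn 2).hom ≫ V ◁ k) ≫ V ◁ X.str.π 2 1 ▷ X.str.T
    have := (L.over_π 2 1).comp L.lift
    rw [← h₁, ← hk₁] at this
    unfold Over at this o
    rw [Category.assoc, ← o 1, ← comp_whiskerRight_assoc, this, Category.assoc,
      Bicategory.whiskerLeft_comp]

/-- Along `V`, the square at `F` becomes isomorphic to the square of `X` at `F ≫ V`. To reflect it,
joint monicity after `T` is taken from `lift_jointly_monic`. -/
lemma lift_universal : ∃ k : L.data.Tn 2 ⟶ L.data.Tn 2 ≫ L.data.T,
    k ≫ L.data.π 2 0 ▷ L.data.T = L.data.π 2 0 ≫ (ρ_ L.data.T).inv ≫ L.data.T ◁ L.data.z ∧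
    k ≫ L.data.π 2 1 ▷ L.data.T = L.data.π 2 1 ≫ L.data.l ∧
    ∀ {Y : K} (F : Y ⟶ I),
      IsPullback (F ◁ (k ≫ L.data.s ▷ L.data.T)) (F ◁ L.data.pn 2) (F ◁ (L.data.p ▷ L.data.T))
        (F ◁ (L.data.z ≫ (λ_ L.data.T).inv)) := by
  obtain ⟨k, hk₀, hk₁, hk⟩ := X.str.lift_universal
  obtain ⟨k', h₀, h₁, h⟩ := L.exists_over_lift hV hk₀ hk₁
  refine ⟨k', h₀, h₁, fun {Y} F => ?_⟩
  have o₁ := (h.comp (L.over_s.whiskerRight L.law.hom)).pastePre F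
  have o₂ := (L.over_pn 2).pastePre F
  have o₃ := (L.over_p.whiskerRight L.law.hom).pastePre F
  have o₄ := (L.over_z.comp (Over.leftUnitor_inv L.law.hom)).pastePre F
  refine hV.isPullback (IsPullback.of_iso (hk (F ≫ V)) (asIso (pastePre F (L.lawn 2).hom)).symm
    (asIso (pastePre F (lawSq L.law.hom L.law.hom))).symm (asIso (pastePre F (idSq V))).symm
    (asIso (pastePre F (lawSq (idSq V) L.law.hom))).symm ?_ ?_ ?_ ?_) ?_
  · simp only [Iso.symm_hom, asIso_inv]
    rw [IsIso.comp_inv_eq, Category.assoc, o₁, IsIso.inv_hom_id_assoc]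
  · simp only [Iso.symm_hom, asIso_inv]
    rw [IsIso.comp_inv_eq, Category.assoc, o₂, IsIso.inv_hom_id_assoc]
  · simp only [Iso.symm_hom, asIso_inv]
    rw [IsIso.comp_inv_eq, Category.assoc, o₃, IsIso.inv_hom_id_assoc]
  · simp only [Iso.symm_hom, asIso_inv]
    rw [IsIso.comp_inv_eq, Category.assoc, o₄, IsIso.inv_hom_id_assoc]
  · intro Q a b ha hb
    rw [← cancel_mono (pastePre F (L.lawn 2).hom ▷ X.str.T)]
    refine X.str.lift_jointly_monic hk₀ hk₁ hk ?_ ?_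
    · rw [Category.assoc, Category.assoc, ← comp_whiskerRight, ← o₁, comp_whiskerRight,
        reassoc_of% ha]
    · rw [Category.assoc, Category.assoc, ← comp_whiskerRight, ← o₂, comp_whiskerRight,
        reassoc_of% hb]

/-- The tangent structure on `I` lifting that of `X`. -/
def tangentStructure : TangentStructure I where
  toTangentData := L.data
  isAdditive := L.isAdditive hV
  isNFoldPullback := L.hasNFold hV
  lift_isHom := L.isHom_lift hV
  flip_isHom := L.isHom_flip hV
  lift_lift := by
    refine hV.over_unique (a' := lawSq (lawSq L.law.hom L.law.hom) L.law.hom)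
      (L.lift.comp (L.lift.whiskerRight L.law.hom)) ?_
    rw [X.str.lift_lift]
    exact L.lift.comp ((L.lift.whiskerLeft L.law.hom).comp (Over.associator_inv _ _ _))
  lift_flip := by
    refine hV.over_unique (L.lift.comp L.flip) ?_
    rw [X.str.lift_flip]
    exact L.lift
  flip_lift := by
    refine hV.over_unique (a' := lawSq L.law.hom (lawSq L.law.hom L.law.hom))
      ((L.lift.whiskerLeft L.law.hom).comp ((Over.associator_inv _ _ _).comp
        ((L.flip.whiskerRight L.law.hom).comp ((Over.associator _ _ _).comp
          (L.flip.whiskerLeft L.law.hom))))) ?_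
    rw [X.str.flip_lift]
    exact L.flip.comp ((L.lift.whiskerRight L.law.hom).comp (Over.associator _ _ _))
  flip_flip := by
    refine hV.over_unique (L.flip.comp L.flip) ?_
    rw [X.str.flip_flip]
    exact Over.id _
  yang_baxter := by
    refine hV.over_unique (a' := lawSq (lawSq L.law.hom L.law.hom) L.law.hom)
      ((L.flip.whiskerRight L.law.hom).comp ((Over.associator _ _ _).comp
        ((L.flip.whiskerLeft L.law.hom).comp ((Over.associator_inv _ _ _).comp
          (L.flip.whiskerRight L.law.hom))))) ?_
    rw [X.str.yang_baxter]
    exact (Over.associator _ _ _).comp ((L.flip.whiskerLeft L.law.hom).comp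
      ((Over.associator_inv _ _ _).comp ((L.flip.whiskerRight L.law.hom).comp
        ((Over.associator _ _ _).comp ((L.flip.whiskerLeft L.law.hom).comp
          (Over.associator_inv _ _ _))))))
  lift_universal := L.lift_universal hV

/-- The tangentad on `I` lifting `X`. -/
abbrev tangentad : Tangentad K := ⟨I, L.tangentStructure hV⟩

lemma isLax : IsLax (L.tangentad hV) X V L.law.hom where
  additive := L.iso.isHom
  lift := L.lift
  flip := L.flip

/-- `V` as a lax tangent 1-morphism. -/
def hom : L.tangentad hV ⟶ X := LaxHom.mk V L.law.hom (L.isLax hV)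

end TangentLift


/-! ### Lax tangent 1-morphisms into a lifted tangentad -/

/-- A converse of `lawComp_paste`: the right-hand square is known and `β'` is invertible, so it can
be cancelled, and whiskering with `V` is faithful. -/
lemma Reflects.lawComp_reflect {I X Y : K} {V : I ⟶ X} {R : X ⟶ X} (hV : Reflects V R)
    {S T : Y ⟶ Y} {S' T' : I ⟶ I} {S'' T'' : X ⟶ X} {F : Y ⟶ I} {α : T ≫ F ⟶ F ≫ T'}
    {β : T' ≫ V ⟶ V ≫ T''} {α' : S ≫ F ⟶ F ≫ S'} {β' : S' ≫ V ⟶ V ≫ S''} (hβ : IsIso β') {l : T ⟶ S}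
    {l' : T' ⟶ S'} {l'' : T'' ⟶ S''}
    (h : l ▷ (F ≫ V) ≫ lawComp α' β' = lawComp α β ≫ (F ≫ V) ◁ l'')
    (h' : l' ▷ V ≫ β' = β ≫ V ◁ l'') : l ▷ F ≫ α' = α ≫ F ◁ l' := by
  refine hV.faithful ?_
  rw [← cancel_mono ((α_ _ _ _).hom ≫ F ◁ β' ≫ (α_ _ _ _).inv), ← cancel_epi (α_ _ _ _).inv]
  calc _ = l ▷ (F ≫ V) ≫ lawComp α' β' := by simp only [lawComp]; bicategory
    _ = (α_ _ _ _).inv ≫ α ▷ V ⊗≫ F ◁ (β ≫ V ◁ l'') ⊗≫ 𝟙 _ := by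
      rw [h]; simp only [lawComp]; bicategory
    _ = _ := by rw [← h']; bicategory

/-- A converse of `whiskerRight_compat`, by the same cancellation. -/
lemma Reflects.compat_reflect {I X Y : K} {V : I ⟶ X} {R : X ⟶ X} (hV : Reflects V R)
    {T : Y ⟶ Y} {T' : I ⟶ I} {T'' : X ⟶ X} {F G : Y ⟶ I} {α : T ≫ F ⟶ F ≫ T'}
    {β : T ≫ G ⟶ G ≫ T'} {γ : T' ≫ V ⟶ V ≫ T''} (hγ : IsIso γ) {φ : F ⟶ G}
    (h : lawComp α γ ≫ φ ▷ V ▷ T'' = T ◁ φ ▷ V ≫ lawComp β γ) : α ≫ φ ▷ T' = T ◁ φ ≫ β := by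
  refine hV.faithful ?_
  have e := whisker_exchange φ γ
  rw [← cancel_mono ((α_ _ _ _).hom ≫ G ◁ γ ≫ (α_ _ _ _).inv), ← cancel_epi (α_ _ _ _).inv]
  calc _ = (α_ _ _ _).inv ≫ α ▷ V ⊗≫ (φ ▷ (T' ≫ V) ≫ G ◁ γ) ⊗≫ 𝟙 _ := by bicategory
    _ = lawComp α γ ≫ φ ▷ V ▷ T'' := by rw [← e]; simp only [lawComp]; bicategory
    _ = _ := by rw [h]; simp only [lawComp]; bicategory

namespace TangentLift

variable {X : Tangentad K} {I : K} {V : I ⟶ X.obj} (L : TangentLift X V)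
  (hV : Reflects V X.str.T) {A : Tangentad K}

lemma isLax_of_lawComp {F : A.obj ⟶ I} {α : A.str.T ≫ F ⟶ F ≫ L.data.T}
    (h : IsLax A X (F ≫ V) (lawComp α L.law.hom)) : IsLax A (L.tangentad hV) F α where
  additive := by
    have := hV.faithful_postcomp A.obj
    refine Bundle.IsHom.of_iso_map (postcomp A.obj V)
      (Bundle.Iso.ofNatIso A.str.bundle (associatorNatIsoLeft A.obj F V))
      (isoComp L.iso F) ((L.hasNFold hV).precomp F 2) (X.str.hasNFold.precomp (F ≫ V) 2)
      h.additive ?_ ?_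
    · change ((λ_ F).hom ≫ (ρ_ F).inv) ▷ V ≫ ((α_ _ _ _).hom ≫ F ◁ ((λ_ V).hom ≫ (ρ_ V).inv)) ≫
        (α_ _ _ _).inv = (α_ _ _ _).hom ≫ (λ_ _).hom ≫ (ρ_ _).inv
      bicategory
    · change α ▷ V ≫ ((α_ _ _ _).hom ≫ F ◁ L.law.hom) ≫ (α_ _ _ _).inv =
        (α_ _ _ _).hom ≫ lawComp α L.law.hom
      simp [lawComp]
  lift := by
    have e := h.lift
    rw [law₂_lawComp] at e
    exact hV.lawComp_reflect (lawSqIso L.law L.law).isIso_hom e L.lift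
  flip := by
    have e := h.flip
    rw [law₂_lawComp] at e
    exact hV.lawComp_reflect (lawSqIso L.law L.law).isIso_hom e L.flip

lemma isCompatible_of_whiskerRight {F G : LaxHom A (L.tangentad hV)} {φ : F.hom ⟶ G.hom}
    (h : IsCompatible (F.comp (L.hom hV)) (G.comp (L.hom hV)) (φ ▷ V)) : IsCompatible F G φ :=
  hV.compat_reflect L.law.isIso_hom h

lemma law_ext {F : A.obj ⟶ I} {α α' : A.str.T ≫ F ⟶ F ≫ L.data.T}
    (hV : Reflects V X.str.T)
    (h : lawComp α L.law.hom = lawComp α' L.law.hom) : α = α' := by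
  refine hV.faithful ?_
  rw [← cancel_mono ((α_ _ _ _).hom ≫ F ◁ L.law.hom ≫ (α_ _ _ _).inv),
    ← cancel_epi (α_ _ _ _).inv]
  exact h

end TangentLift

/-! ### Construction of lifts -/

section Construction

variable {X : Tangentad K} {I : K} {V : I ⟶ X.obj}

/-- A lift of the tangent structure from lifts of its constituents. -/
noncomputable def TangentLift.ofExists (hV : Reflects V X.str.T) {T : I ⟶ I} {Tn : ℕ → (I ⟶ I)}
    (law : T ≫ V ≅ V ≫ X.str.T) (lawn : ∀ n, Tn n ≫ V ≅ V ≫ X.str.Tn n)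
    (hp : ∃ p, Over law.hom (idSq V) p X.str.p) (hz : ∃ z, Over (idSq V) law.hom z X.str.z)
    (hpn : ∀ n, ∃ p, Over (lawn n).hom (idSq V) p (X.str.pn n))
    (hπ : ∀ n i, ∃ p, Over (lawn n).hom law.hom p (X.str.π n i))
    (hs : ∃ s, Over (lawn 2).hom law.hom s X.str.s)
    (hl : ∃ l, Over law.hom (lawSq law.hom law.hom) l X.str.l)
    (hc : ∃ c, Over (lawSq law.hom law.hom) (lawSq law.hom law.hom) c X.str.c) :
    TangentLift X V where
  data :=
    { T := T
      p := hp.choose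
      Tn := Tn
      pn := fun n => (hpn n).choose
      π := fun n i => (hπ n i).choose
      π_p := fun n i => by
        refine hV.over_unique (ψ := X.str.pn n) (a := (lawn n).hom) (a' := idSq V) ?_
          (hpn n).choose_spec
        rw [← X.str.π_p n i]
        exact (hπ n i).choose_spec.comp hp.choose_spec
      z := hz.choose
      s := hs.choose
      l := hl.choose
      c := hc.choose }
  law := law
  lawn := lawn
  over_p := hp.choose_spec
  over_z := hz.choose_spec
  over_pn n := (hpn n).choose_spec
  over_π n i := (hπ n i).choose_spec
  over_s := hs.choose_spec
  lift := hl.choose_spec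
  flip := hc.choose_spec

end Construction

/-! ### The flip as a distributive law of `T` over the tangent structure -/

namespace TangentStructure

variable {X : K} (t : TangentStructure X)

/-- This and the following identities are the hypothesis `hψ` of `IsInserter.exists_over` for each
structure 2-morphism. -/
lemma flip_p : t.c ≫ t.p ▷ t.T = t.T ◁ t.p ≫ (ρ_ t.T).hom ≫ (λ_ t.T).inv :=
  (projCell ⟨X, t⟩).comm

lemma flip_z : ((ρ_ t.T).hom ≫ (λ_ t.T).inv) ≫ t.z ▷ t.T = t.T ◁ t.z ≫ t.c := by
  have : IsIso t.c := ⟨t.c, t.flip_flip, t.flip_flip⟩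
  rw [← cancel_mono t.c, Category.assoc, Category.assoc, Category.assoc, t.z_comp_flip, t.flip_flip]
  simp

lemma flip_l : t.c ≫ t.l ▷ t.T = t.T ◁ t.l ≫ lawComp t.c t.c := by
  have h := congrArg (· ≫ (α_ _ _ _).inv) t.flip_lift
  simp only [Category.assoc, Iso.hom_inv_id, Category.comp_id] at h
  simpa only [lawComp] using h.symm

lemma flip_c : lawComp t.c t.c ≫ t.c ▷ t.T = t.T ◁ t.c ≫ lawComp t.c t.c :=
  (flipCell ⟨X, t⟩).comm

/-- The law `T_n ∘ T ⇒ T ∘ T_n` is the flip on each component; it exists because `T ∘ T_n` is a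
pullback. The base condition is recorded separately for the sake of `n = 0`. -/
lemma exists_flipn (n : ℕ) : ∃ d : t.T ≫ t.Tn n ⟶ t.Tn n ≫ t.T,
    (∀ i, d ≫ t.π n i ▷ t.T = t.T ◁ t.π n i ≫ t.c) ∧
    d ≫ t.pn n ▷ t.T = t.T ◁ t.pn n ≫ (ρ_ t.T).hom ≫ (λ_ t.T).inv := by
  obtain ⟨d, h₀, h₁⟩ := (t.hasNFold.postcomp n).exists_lift
    (t.T ◁ t.pn n ≫ (ρ_ t.T).hom ≫ (λ_ t.T).inv) (fun i => t.T ◁ t.π n i ≫ t.c) (fun i => by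
      change (t.T ◁ t.π n i ≫ t.c) ≫ t.p ▷ t.T = _
      rw [Category.assoc, t.flip_p, ← Bicategory.whiskerLeft_comp_assoc, t.π_p]
      rfl)
  exact ⟨d, h₁, h₀⟩

/-- Needed for `T_n` to restrict to the equifier. It is checked on the projections of `T_n`, where
it is the corresponding property of `c`. -/
lemma flipn_p {n : ℕ} {d : t.T ≫ t.Tn n ⟶ t.Tn n ≫ t.T}
    (h : ∀ i, d ≫ t.π n i ▷ t.T = t.T ◁ t.π n i ≫ t.c)
    (h₀ : d ≫ t.pn n ▷ t.T = t.T ◁ t.pn n ≫ (ρ_ t.T).hom ≫ (λ_ t.T).inv) :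
    d ≫ t.Tn n ◁ t.p = t.p ▷ t.Tn n ≫ (λ_ _).hom ≫ (ρ_ _).inv := by
  rw [← cancel_mono (ρ_ (t.Tn n)).hom]
  refine (t.hasNFold.bundle n).hom_ext ?_ fun i => ?_
  · change ((d ≫ t.Tn n ◁ t.p) ≫ (ρ_ _).hom) ≫ t.pn n =
      ((t.p ▷ t.Tn n ≫ (λ_ _).hom ≫ (ρ_ _).inv) ≫ (ρ_ _).hom) ≫ t.pn n
    calc _ = (d ≫ (t.Tn n ◁ t.p ≫ t.pn n ▷ 𝟙 X)) ≫ (ρ_ _).hom := by simp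
      _ = (d ≫ t.pn n ▷ t.T) ≫ (λ_ _).hom ≫ t.p := by rw [whisker_exchange]; simp
      _ = (t.T ◁ t.pn n ≫ t.p ▷ 𝟙 X) ≫ (ρ_ _).hom := by rw [h₀]; simp
      _ = _ := by rw [whisker_exchange]; simp
  · change ((d ≫ t.Tn n ◁ t.p) ≫ (ρ_ _).hom) ≫ t.π n i =
      ((t.p ▷ t.Tn n ≫ (λ_ _).hom ≫ (ρ_ _).inv) ≫ (ρ_ _).hom) ≫ t.π n i
    calc _ = (d ≫ (t.Tn n ◁ t.p ≫ t.π n i ▷ 𝟙 X)) ≫ (ρ_ _).hom := by simp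
      _ = (d ≫ t.π n i ▷ t.T) ≫ t.T ◁ t.p ≫ (ρ_ _).hom := by rw [whisker_exchange]; simp
      _ = (t.T ◁ t.π n i ≫ t.p ▷ t.T) ≫ (λ_ _).hom := by
          rw [h, Category.assoc, reassoc_of% t.flip_comp_p]; simp
      _ = _ := by rw [whisker_exchange]; simp

/-- The axiom on `c` and sums concerns the componentwise flip `e` in the opposite direction. Since
`c² = id`, `d` followed by `e` is the identity, which transfers the axiom to `d`. -/
lemma flipn_s {d : t.T ≫ t.Tn 2 ⟶ t.Tn 2 ≫ t.T}
    (h : ∀ i, d ≫ t.π 2 i ▷ t.T = t.T ◁ t.π 2 i ≫ t.c) :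
    d ≫ t.s ▷ t.T = t.T ◁ t.s ≫ t.c := by
  obtain ⟨e, h₁, h₂⟩ := t.flip_isHom.sum_comp
  change t.Tn 2 ≫ t.T ⟶ t.T ≫ t.Tn 2 at e
  replace h₁ : ∀ i, e ≫ t.T ◁ t.π 2 i = t.π 2 i ▷ t.T ≫ t.c := h₁
  replace h₂ : t.s ▷ t.T ≫ t.c = e ≫ t.T ◁ t.s := h₂
  have hde : d ≫ e = 𝟙 _ := by
    refine (t.hasNFold.precomp t.T 2).hom_ext₂ fun i => ?_
    change (d ≫ e) ≫ t.T ◁ t.π 2 i = 𝟙 _ ≫ t.T ◁ t.π 2 i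
    rw [Category.assoc, h₁, reassoc_of% h i, t.flip_flip]
    simp
  have : IsIso t.c := ⟨t.c, t.flip_flip, t.flip_flip⟩
  rw [← cancel_mono t.c, Category.assoc, h₂, reassoc_of% hde, Category.assoc, t.flip_flip,
    Category.comp_id]

end TangentStructure


/-! ### Inserters of the identity and an endomorphism -/

namespace IsInserter

variable {X I : K} {T : X ⟶ X} {V : I ⟶ X} {θ : V ⟶ V ≫ T}
  (hI : IsInserter (𝟙 X) T V ((ρ_ V).hom ≫ θ))
include hI

lemma faithful {Y : K} {H H' : Y ⟶ I} {φ ψ : H ⟶ H'} (h : φ ▷ V = ψ ▷ V) : φ = ψ :=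
  ((hI Y).bijective_map H H').1 (Insert.Hom.ext h)

/-- The universal property on 2-morphisms, with the unitors of `𝟙 X` removed: coalgebra maps lift
along `V`. -/
lemma exists_cell {Y : K} {H H' : Y ⟶ I} (φ : H ≫ V ⟶ H' ≫ V)
    (h : (H ◁ θ ≫ (α_ _ _ _).inv) ≫ φ ▷ T = φ ≫ H' ◁ θ ≫ (α_ _ _ _).inv) :
    ∃ ψ : H ⟶ H', ψ ▷ V = φ := by
  obtain ⟨ψ, hψ⟩ := ((hI Y).bijective_map H H').2 ⟨φ, by
    change φ ▷ 𝟙 X ≫ (α_ _ _ _).hom ≫ H' ◁ ((ρ_ V).hom ≫ θ) ≫ (α_ _ _ _).inv =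
      ((α_ _ _ _).hom ≫ H ◁ ((ρ_ V).hom ≫ θ) ≫ (α_ _ _ _).inv) ≫ φ ▷ T
    calc _ = (ρ_ _).hom ≫ φ ≫ H' ◁ θ ≫ (α_ _ _ _).inv := by bicategory
      _ = _ := by rw [← h]; bicategory⟩
  exact ⟨ψ, congrArg Insert.Hom.cell hψ⟩

lemma exists_hom {Y : K} (H : Y ⟶ X) (τ : H ⟶ H ≫ T) :
    ∃ (L : Y ⟶ I) (e : L ≫ V = H),
      eqToHom e ≫ τ = (L ◁ θ ≫ (α_ _ _ _).inv) ≫ eqToHom e ▷ T := by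
  obtain ⟨L, hL⟩ := (hI Y).bijective_obj.2 ⟨H, (ρ_ H).hom ≫ τ⟩
  have e : L ≫ V = H := congrArg Insert.hom hL
  subst e
  have h : (α_ L V (𝟙 X)).hom ≫ L ◁ ((ρ_ V).hom ≫ θ) ≫ (α_ L V T).inv = (ρ_ _).hom ≫ τ :=
    eq_of_heq (Insert.mk.inj hL).2
  refine ⟨L, rfl, ?_⟩
  rw [eqToHom_refl, Category.id_comp, id_whiskerRight, Category.comp_id,
    ← cancel_epi (ρ_ _).hom, ← h]
  bicategory

lemma hom_ext {Y : K} {L L' : Y ⟶ I} (e : L ≫ V = L' ≫ V)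
    (h : (L ◁ θ ≫ (α_ _ _ _).inv) ≫ eqToHom e ▷ T = eqToHom e ≫ L' ◁ θ ≫ (α_ _ _ _).inv) :
    L = L' := by
  refine (hI Y).bijective_obj.1 ?_
  have key : ∀ {H H' : Y ⟶ X} (e : H = H') (τ : H ≫ 𝟙 X ⟶ H ≫ T) (τ' : H' ≫ 𝟙 X ⟶ H' ≫ T),
      τ ≫ eqToHom e ▷ T = eqToHom e ▷ 𝟙 X ≫ τ' → Insert.mk H τ = Insert.mk H' τ' := by
    rintro H _ rfl τ τ' h
    simp only [eqToHom_refl, id_whiskerRight, Category.id_comp, Category.comp_id] at h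
    rw [h]
  refine key e _ _ ?_
  calc _ = (ρ_ _).hom ≫ (L ◁ θ ≫ (α_ _ _ _).inv) ≫ eqToHom e ▷ T := by bicategory
    _ = _ := by rw [h]; bicategory

/-- `m` lifts when `θ_P · m = T m · θ_Z`. After composing with `T V fᵢ`, both sides become `T V xᵢ ·
θ_Z`, by naturality of `θ` along `fᵢ` and `xᵢ`; joint monicity of the `T V fᵢ` concludes. -/
lemma reflects : Reflects V T where
  faithful := hI.faithful
  exists_lift {Y Z P} m {ι B} f x hx hT := by
    refine hI.exists_cell m (hT _ _ fun i => ?_)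
    have e₁ := VectorField.hom_whisker θ (x i)
    have e₂ := VectorField.hom_whisker θ (f i)
    rw [Category.assoc _ _ (f i ▷ V ▷ T), ← comp_whiskerRight, hx i, e₁, Category.assoc m, e₂,
      reassoc_of% hx i]

end IsInserter

/-! ### Lifting endomorphisms to the inserter -/

/-- The square `a` identifies the coalgebra structure `θ` restricted along `S`, with the coalgebra
structure on `V ≫ A` given by `θ` and `d`. -/
def IsCoalgSq {X I : K} {T : X ⟶ X} {V : I ⟶ X} (θ : V ⟶ V ≫ T) {S : I ⟶ I} {A : X ⟶ X}
    (a : S ≫ V ⟶ V ≫ A) (d : T ≫ A ⟶ A ≫ T) : Prop :=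
  a ≫ θ ▷ A ≫ (α_ _ _ _).hom ≫ V ◁ d ≫ (α_ _ _ _).inv = S ◁ θ ≫ (α_ _ _ _).inv ≫ a ▷ T

section IsCoalgSq

variable {X I : K} {T : X ⟶ X} {V : I ⟶ X} {θ : V ⟶ V ≫ T}

lemma isCoalgSq_id (θ : V ⟶ V ≫ T) : IsCoalgSq θ (idSq V) ((ρ_ T).hom ≫ (λ_ T).inv) := by
  unfold IsCoalgSq
  bicategory

lemma IsCoalgSq.comp {S S' : I ⟶ I} {A A' : X ⟶ X} {a : S ≫ V ⟶ V ≫ A} {a' : S' ≫ V ⟶ V ≫ A'}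
    {d : T ≫ A ⟶ A ≫ T} {d' : T ≫ A' ⟶ A' ≫ T} (h : IsCoalgSq θ a d) (h' : IsCoalgSq θ a' d') :
    IsCoalgSq θ (lawSq a a') (lawComp d d') := by
  unfold IsCoalgSq lawSq lawComp at *
  calc _ = 𝟙 _ ⊗≫ S ◁ a' ⊗≫ (a ≫ θ ▷ A ≫ (α_ _ _ _).hom ≫ V ◁ d ≫ (α_ _ _ _).inv) ▷ A' ⊗≫
        V ◁ A ◁ d' ⊗≫ 𝟙 _ := by bicategory
    _ = 𝟙 _ ⊗≫ S ◁ (a' ≫ θ ▷ A') ⊗≫ (a ▷ (T ≫ A') ≫ (V ≫ A) ◁ d') ⊗≫ 𝟙 _ := by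
      rw [h]; bicategory
    _ = 𝟙 _ ⊗≫ S ◁ (a' ≫ θ ▷ A' ≫ (α_ _ _ _).hom ≫ V ◁ d' ≫ (α_ _ _ _).inv) ⊗≫ a ▷ A' ▷ T ⊗≫
        𝟙 _ := by rw [← whisker_exchange]; bicategory
    _ = _ := by rw [h']; bicategory

/-- The coalgebra structure on `A ∘ V` is `d_V · Aθ`, and `hd` says `p_A · d = A p`, so projecting
it gives `A (p_V · θ)`. -/
lemma IsCoalgSq.whiskerLeft_projected {p : T ⟶ 𝟙 X} {S : I ⟶ I} {A : X ⟶ X}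
    {a : S ≫ V ⟶ V ≫ A} {d : T ≫ A ⟶ A ≫ T} (h : IsCoalgSq θ a d)
    (hd : d ≫ A ◁ p = p ▷ A ≫ (λ_ _).hom ≫ (ρ_ _).inv) :
    S ◁ projected p ((ρ_ V).hom ≫ θ) ≫ a = a ≫ projected p ((ρ_ V).hom ≫ θ) ▷ A := by
  unfold IsCoalgSq projected at *
  calc _ = 𝟙 _ ⊗≫ S ◁ θ ⊗≫ ((S ≫ V) ◁ p ≫ a ▷ 𝟙 X) ⊗≫ 𝟙 _ := by bicategory
    _ = (S ◁ θ ≫ (α_ _ _ _).inv ≫ a ▷ T) ⊗≫ V ◁ A ◁ p ⊗≫ 𝟙 _ := by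
      rw [whisker_exchange]; bicategory
    _ = a ≫ θ ▷ A ⊗≫ V ◁ (d ≫ A ◁ p) ⊗≫ 𝟙 _ := by rw [← h]; bicategory
    _ = _ := by rw [hd]; bicategory

variable (hI : IsInserter (𝟙 X) T V ((ρ_ V).hom ≫ θ))
include hI

/-- `S` is the 1-morphism classifying the coalgebra `(A ∘ V, d_V · Aθ)`. The comparison is an
equality, whence the strictness of `V`. -/
lemma IsInserter.exists_isCoalgSq {A : X ⟶ X} (d : T ≫ A ⟶ A ≫ T) :
    ∃ (S : I ⟶ I) (e : S ≫ V = V ≫ A), IsCoalgSq θ (eqToHom e) d := by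
  obtain ⟨S, e, h⟩ := hI.exists_hom (V ≫ A) (θ ▷ A ≫ (α_ _ _ _).hom ≫ V ◁ d ≫ (α_ _ _ _).inv)
  exact ⟨S, e, by rw [IsCoalgSq, h, Category.assoc]⟩

/-- By `hψ` and interchange, `ψ_V` is a coalgebra map from `A ∘ V` to `A' ∘ V`. -/
lemma IsInserter.exists_over {S S' : I ⟶ I} {A A' : X ⟶ X} {a : S ≫ V ⟶ V ≫ A}
    {a' : S' ≫ V ⟶ V ≫ A'} [IsIso a'] {d : T ≫ A ⟶ A ≫ T} {d' : T ≫ A' ⟶ A' ≫ T}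
    (h : IsCoalgSq θ a d) (h' : IsCoalgSq θ a' d') {ψ : A ⟶ A'} (hψ : d ≫ ψ ▷ T = T ◁ ψ ≫ d') :
    ∃ φ : S ⟶ S', Over a a' φ ψ := by
  unfold IsCoalgSq at h h'
  obtain ⟨φ, hφ⟩ := hI.exists_cell (H := S) (H' := S') (a ≫ V ◁ ψ ≫ inv a') (by
    rw [← cancel_mono (a' ▷ T)]
    calc _ = (S ◁ θ ≫ (α_ _ _ _).inv ≫ a ▷ T) ≫ (V ◁ ψ) ▷ T ≫ (inv a' ≫ a') ▷ T := by
          simp only [comp_whiskerRight, Category.assoc]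
      _ = a ≫ θ ▷ A ⊗≫ V ◁ (d ≫ ψ ▷ T) ⊗≫ 𝟙 _ := by
          rw [← h, IsIso.inv_hom_id, id_whiskerRight]; bicategory
      _ = a ≫ (θ ▷ A ≫ (V ≫ T) ◁ ψ) ⊗≫ V ◁ d' ⊗≫ 𝟙 _ := by rw [hψ]; bicategory
      _ = a ≫ V ◁ ψ ≫ inv a' ≫ (a' ≫ θ ▷ A' ≫ (α_ _ _ _).hom ≫ V ◁ d' ≫ (α_ _ _ _).inv) := by
          rw [← whisker_exchange, IsIso.inv_hom_id_assoc]; bicategory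
      _ = _ := by rw [h']; simp only [Category.assoc])
  exact ⟨φ, by rw [Over, hφ]; simp⟩

end IsCoalgSq

/-- The inserter of the identity and the tangent bundle 1-morphism inherits a lift of the tangent
structure. -/
theorem IsInserter.exists_tangentLift {X : Tangentad K} {I : K} {V : I ⟶ X.obj}
    {θ : V ⟶ V ≫ X.str.T} (hI : IsInserter (𝟙 X.obj) X.str.T V ((ρ_ V).hom ≫ θ)) :
    ∃ L : TangentLift X V, (∃ e, L.law.hom = eqToHom e) ∧ IsCoalgSq θ L.law.hom X.str.c ∧
      ∀ n, ∃ d, IsCoalgSq θ (L.lawn n).hom d ∧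
        d ≫ X.str.Tn n ◁ X.str.p = X.str.p ▷ X.str.Tn n ≫ (λ_ _).hom ≫ (ρ_ _).inv := by
  obtain ⟨T, e, hT⟩ := hI.exists_isCoalgSq X.str.c
  choose d hd₁ hd₀ using X.str.exists_flipn
  choose Tn en hn using fun n => hI.exists_isCoalgSq (d n)
  refine ⟨TangentLift.ofExists hI.reflects (T := T) (Tn := Tn) (eqToIso e)
    (fun n => eqToIso (en n)) ?_ ?_ ?_ ?_ ?_ ?_ ?_, ⟨e, rfl⟩, hT,
    fun n => ⟨d n, hn n, X.str.flipn_p (hd₁ n) (hd₀ n)⟩⟩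
  · exact hI.exists_over hT (isCoalgSq_id θ) X.str.flip_p
  · exact hI.exists_over (isCoalgSq_id θ) hT X.str.flip_z
  · exact fun n => hI.exists_over (hn n) (isCoalgSq_id θ) (hd₀ n)
  · exact fun n i => hI.exists_over (hn n) hT (hd₁ n i)
  · exact hI.exists_over (hn 2) hT (X.str.flipn_s (hd₁ 2))
  · exact hI.exists_over hT (hT.comp hT) X.str.flip_l
  · exact hI.exists_over (hT.comp hT) (hT.comp hT) X.str.flip_c


/-! ### Equifiers -/

lemma isEquifier_of_bijective {X X' : K} {F G : X ⟶ X'} {φ ψ : F ⟶ G} {E : K} {W : E ⟶ X}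
    (h : W ◁ φ = W ◁ ψ)
    (inj : ∀ {Y : K} {H H' : Y ⟶ E}, H ≫ W = H' ≫ W → H = H')
    (surj : ∀ {Y : K} (H : Y ⟶ X), H ◁ φ = H ◁ ψ → ∃ L : Y ⟶ E, L ≫ W = H)
    (cell : ∀ {Y : K} (H H' : Y ⟶ E),
      Function.Bijective fun f : H ⟶ H' => (f ▷ W : H ≫ W ⟶ H' ≫ W)) :
    IsEquifier φ ψ W := by
  refine ⟨h, fun Y => isIsoOfCategories_of_bijective _ ⟨fun H H' e => ?_, fun H => ?_⟩
    fun H H' => ⟨fun f g e => ?_, fun f => ?_⟩⟩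
  · exact inj (congrArg ObjectProperty.FullSubcategory.obj e)
  · obtain ⟨L, hL⟩ := surj H.obj H.property
    exact ⟨L, ObjectProperty.FullSubcategory.ext hL⟩
  · exact (cell H H').1 (congrArg InducedCategory.Hom.hom e)
  · obtain ⟨g, hg⟩ := (cell H H').2 f.hom
    exact ⟨g, InducedCategory.hom_ext hg⟩

namespace IsEquifier

variable {X X' : K} {F G : X ⟶ X'} {φ ψ : F ⟶ G} {E : K} {W : E ⟶ X} (hE : IsEquifier φ ψ W)
include hE

lemma bijective_cell {Y : K} (H H' : Y ⟶ E) :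
    Function.Bijective fun f : H ⟶ H' => (f ▷ W : H ≫ W ⟶ H' ≫ W) := by
  obtain ⟨h, hE⟩ := hE
  refine ⟨fun f g e => ((hE Y).bijective_map H H').1 (InducedCategory.hom_ext e), fun m => ?_⟩
  obtain ⟨f, hf⟩ := ((hE Y).bijective_map H H').2 (ObjectProperty.homMk m)
  exact ⟨f, congrArg InducedCategory.Hom.hom hf⟩

lemma exists_hom {Y : K} (H : Y ⟶ X) (hH : H ◁ φ = H ◁ ψ) : ∃ L : Y ⟶ E, L ≫ W = H := by
  obtain ⟨h, hE⟩ := hE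
  obtain ⟨L, hL⟩ := (hE Y).bijective_obj.2 ⟨H, hH⟩
  exact ⟨L, congrArg ObjectProperty.FullSubcategory.obj hL⟩

lemma hom_ext {Y : K} {L L' : Y ⟶ E} (h : L ≫ W = L' ≫ W) : L = L' := by
  obtain ⟨_, hE⟩ := hE
  exact (hE Y).bijective_obj.1 (ObjectProperty.FullSubcategory.ext h)

/-- Whiskering with `W` is fully faithful, so every `m` lifts and the test family plays no role. -/
lemma reflects (T : X ⟶ X) : Reflects W T where
  faithful h := (hE.bijective_cell _ _).1 h
  exists_lift m _ _ _ _ _ _ := (hE.bijective_cell _ _).2 m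

lemma exists_over {S S' : E ⟶ E} {A A' : X ⟶ X} {a : S ≫ W ⟶ W ≫ A}
    {a' : S' ≫ W ⟶ W ≫ A'} (ha : IsIso a') (χ : A ⟶ A') : ∃ f : S ⟶ S', Over a a' f χ := by
  obtain ⟨f, hf⟩ := (hE.bijective_cell S S').2 (a ≫ W ◁ χ ≫ inv a')
  have hf : f ▷ W = a ≫ W ◁ χ ≫ inv a' := hf
  exact ⟨f, by rw [Over, hf]; simp⟩

end IsEquifier

/-- An equifier inherits a lift of the tangent structure if the 1-morphisms `T` and `T_n` restrict
to it. -/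
theorem IsEquifier.exists_tangentLift {A : Tangentad K} {X' : K} {F G : A.obj ⟶ X'} {φ ψ : F ⟶ G}
    {E : K} {W : E ⟶ A.obj} (hE : IsEquifier φ ψ W)
    (hT : (W ≫ A.str.T) ◁ φ = (W ≫ A.str.T) ◁ ψ)
    (hTn : ∀ n, (W ≫ A.str.Tn n) ◁ φ = (W ≫ A.str.Tn n) ◁ ψ) :
    ∃ L : TangentLift A W, ∃ e, L.law.hom = eqToHom e := by
  obtain ⟨T, e⟩ := hE.exists_hom _ hT
  choose Tn en using fun n => hE.exists_hom _ (hTn n)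
  have i₀ : IsIso (idSq W) := inferInstance
  have i₁ : IsIso (lawSq (eqToIso e).hom (eqToIso e).hom) := inferInstance
  exact ⟨TangentLift.ofExists (hE.reflects A.str.T) (T := T) (Tn := Tn) (eqToIso e)
    (fun n => eqToIso (en n)) (hE.exists_over i₀ _) (hE.exists_over (Iso.isIso_hom _) _)
    (fun n => hE.exists_over i₀ _) (fun n i => hE.exists_over (Iso.isIso_hom _) _)
    (hE.exists_over (Iso.isIso_hom _) _) (hE.exists_over i₁ _) (hE.exists_over i₁ _), e, rfl⟩

/-- An equifier in `K` with a lifted tangent structure is an equifier in `Tng(K)`. -/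
theorem IsEquifier.tangentad {A B : Tangentad K} {F G : A ⟶ B} {φ ψ : F ⟶ G} {E : K}
    {W : E ⟶ A.obj} (hE : IsEquifier (TangentCell.cell φ) (TangentCell.cell ψ) W)
    (L : TangentLift A W) :
    IsEquifier φ ψ (L.hom (hE.reflects A.str.T)) := by
  refine isEquifier_of_bijective (cell_ext hE.choose) ?_ ?_ ?_
  · rintro Y ⟨H, h, hl⟩ ⟨H', h', hl'⟩ e
    replace e : LaxHom.mk (H ≫ W) (lawComp h L.law.hom) _ =
      LaxHom.mk (H' ≫ W) (lawComp h' L.law.hom) _ := e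
    obtain ⟨e₁, e₂⟩ := LaxHom.mk.inj e
    obtain rfl := hE.hom_ext e₁
    obtain rfl := L.law_ext (hE.reflects A.str.T) (eq_of_heq e₂)
    rfl
  · rintro Y ⟨H, h, hl⟩ hH
    obtain ⟨H, rfl⟩ := hE.exists_hom H (congrArg TangentCell.cell hH)
    -- The law is forced: it must lift `h` followed by the inverse of the law of `W`.
    obtain ⟨k, hk⟩ := (hE.bijective_cell (Y.str.T ≫ H) (H ≫ L.data.T)).2
      ((α_ _ _ _).hom ≫ h ≫ (α_ _ _ _).hom ≫ H ◁ L.law.inv ≫ (α_ _ _ _).inv)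
    have hk : k ▷ W = (α_ _ _ _).hom ≫ h ≫ (α_ _ _ _).hom ≫ H ◁ L.law.inv ≫ (α_ _ _ _).inv := hk
    obtain rfl : lawComp k L.law.hom = h := by simp [lawComp, hk, ← whiskerLeft_comp_assoc]
    exact ⟨LaxHom.mk H k (L.isLax_of_lawComp _ hl), rfl⟩
  · intro Y H H'
    refine ⟨fun f g e => cell_ext ((hE.bijective_cell _ _).1 (congrArg TangentCell.cell e)), ?_⟩
    rintro ⟨m, hm⟩
    obtain ⟨f, rfl⟩ := (hE.bijective_cell H.hom H'.hom).2 m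
    exact ⟨TangentCell.mk f (L.isCompatible_of_whiskerRight (hE.reflects A.str.T) hm), rfl⟩

/-! ### The inserter in tangentads -/

/-- Laws for `F` over `h` are lifts of `h` corrected by `a⁻¹`. By `hh`, composed with `c` so that
`c² = id` removes the flip, and by `ha`, this 2-morphism is a coalgebra map. -/
lemma IsInserter.exists_law {X I Y : K} {T : X ⟶ X} {V : I ⟶ X} {θ : V ⟶ V ≫ T}
    (hI : IsInserter (𝟙 X) T V ((ρ_ V).hom ≫ θ)) {S : I ⟶ I} {a : S ≫ V ≅ V ≫ T}
    {c : T ≫ T ⟶ T ≫ T} (hc : c ≫ c = 𝟙 _) (ha : IsCoalgSq θ a.hom c) {R : Y ⟶ Y} {F : Y ⟶ I}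
    {h : R ≫ F ≫ V ⟶ (F ≫ V) ≫ T}
    (hh : h ≫ (F ◁ θ ≫ (α_ _ _ _).inv) ▷ T = R ◁ (F ◁ θ ≫ (α_ _ _ _).inv) ≫ lawComp h c) :
    ∃ k : R ≫ F ⟶ F ≫ S, lawComp k a.hom = h := by
  obtain ⟨k, hk⟩ := hI.exists_cell (H := R ≫ F) (H' := F ≫ S)
    ((α_ _ _ _).hom ≫ h ≫ (α_ _ _ _).hom ≫ F ◁ a.inv ≫ (α_ _ _ _).inv) (by
      have hh' : h ≫ (F ◁ θ ≫ (α_ _ _ _).inv) ▷ T ≫ (α_ _ _ _).hom ≫ (F ≫ V) ◁ c ≫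
          (α_ _ _ _).inv = R ◁ (F ◁ θ ≫ (α_ _ _ _).inv) ≫ (α_ _ _ _).inv ≫ h ▷ T := by
        rw [reassoc_of% hh]
        simp only [Iso.inv_hom_id_assoc]
        rw [← whiskerLeft_comp_assoc (F ≫ V), hc]
        simp
      rw [IsCoalgSq] at ha
      have ha' : a.inv ≫ S ◁ θ ≫ (α_ _ _ _).inv = θ ▷ T ≫ (α_ _ _ _).hom ≫ V ◁ c ≫
          (α_ _ _ _).inv ≫ a.inv ▷ T := by
        rw [Iso.inv_comp_eq, ← cancel_mono (a.hom ▷ T)]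
        simp only [Category.assoc, inv_hom_whiskerRight, Category.comp_id]
        exact ha.symm
      calc _ = (α_ _ _ _).hom ≫ (R ◁ (F ◁ θ ≫ (α_ _ _ _).inv) ≫ (α_ _ _ _).inv ≫ h ▷ T) ⊗≫
            F ◁ a.inv ▷ T ⊗≫ 𝟙 _ := by bicategory
        _ = (α_ _ _ _).hom ≫ h ⊗≫ F ◁ (θ ▷ T ≫ (α_ _ _ _).hom ≫ V ◁ c ≫
              (α_ _ _ _).inv ≫ a.inv ▷ T) ⊗≫ 𝟙 _ := by rw [← hh']; bicategory
        _ = _ := by rw [← ha']; bicategory)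
  exact ⟨k, by simp [lawComp, hk, ← whiskerLeft_comp_assoc]⟩

/-- The coalgebra square for the flip and the compatibility of `θ` with laws differ by moving `c` to
the other side, which `c² = id` allows. -/
lemma isCompatible_of_isCoalgSq {X : Tangentad K} {I : K} {V : I ⟶ X.obj} {θ : V ⟶ V ≫ X.str.T}
    {L : TangentLift X V} (hV : Reflects V X.str.T) (hL : IsCoalgSq θ L.law.hom X.str.c) :
    IsCompatible (L.hom hV ≫ 𝟙 X) (L.hom hV ≫ tangentHom X) ((ρ_ V).hom ≫ θ) := by
  change lawComp L.law.hom ((ρ_ _).hom ≫ (λ_ _).inv) ≫ ((ρ_ V).hom ≫ θ) ▷ X.str.T =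
    L.data.T ◁ ((ρ_ V).hom ≫ θ) ≫ lawComp L.law.hom X.str.c
  have h : L.law.hom ≫ θ ▷ X.str.T = L.data.T ◁ θ ≫ lawComp L.law.hom X.str.c := by
    have h := hL =≫ ((α_ _ _ _).hom ≫ V ◁ X.str.c ≫ (α_ _ _ _).inv)
    simp only [Category.assoc, Iso.inv_hom_id_assoc] at h
    rw [← whiskerLeft_comp_assoc V, X.str.flip_flip, Bicategory.whiskerLeft_id,
      Category.id_comp, Iso.hom_inv_id, Category.comp_id] at h
    exact h
  calc _ = L.data.T ◁ (ρ_ V).hom ≫ L.law.hom ≫ θ ▷ X.str.T := by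
        simp only [lawComp]; bicategory
    _ = _ := by rw [h, Bicategory.whiskerLeft_comp, Category.assoc]

/-- The inserter in `K` with the lifted tangent structure is an inserter in `Tng(K)`. -/
theorem IsInserter.tangentad {X : Tangentad K} {I : K} {V : I ⟶ X.obj} {θ : V ⟶ V ≫ X.str.T}
    (hI : IsInserter (𝟙 X.obj) X.str.T V ((ρ_ V).hom ≫ θ)) {L : TangentLift X V}
    (hL : IsCoalgSq θ L.law.hom X.str.c) :
    IsInserter (𝟙 X) (tangentHom X) (L.hom hI.reflects)
      (TangentCell.mk ((ρ_ V).hom ≫ θ) (isCompatible_of_isCoalgSq hI.reflects hL)) := by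
  refine fun A => isIsoOfCategories_of_bijective _ ⟨?_, ?_⟩ fun F F' => ⟨fun f g e => ?_, ?_⟩
  · rintro ⟨H, h, hl⟩ ⟨H', h', hl'⟩ e
    have e₀ : LaxHom.mk (H ≫ V) (lawComp h L.law.hom) _ =
      LaxHom.mk (H' ≫ V) (lawComp h' L.law.hom) _ := congrArg Insert.hom e
    -- Forgetting the laws reduces to injectivity in `K`; the laws are then compared after `V`.
    have e₁ := congrArg (fun i : Insert (𝟙 X) (tangentHom X) A =>
      (Insert.mk (LaxHom.hom i.hom) (TangentCell.cell i.cell) :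
        Insert (𝟙 X.obj) X.str.T A.obj)) e
    obtain rfl : H = H' := (hI A.obj).bijective_obj.1 e₁
    obtain rfl := L.law_ext hI.reflects (eq_of_heq (LaxHom.mk.inj e₀).2)
    rfl
  · rintro ⟨⟨H, h, hl⟩, ⟨τ, hτ⟩⟩
    obtain ⟨F, hF⟩ := (hI A.obj).bijective_obj.2 ⟨H, τ⟩
    obtain ⟨e₁, e₂⟩ := Insert.mk.inj hF
    subst e₁
    obtain rfl := eq_of_heq e₂
    obtain ⟨k, rfl⟩ := hI.exists_law X.str.flip_flip hL (h := h) (R := A.str.T) (by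
      change lawComp h ((ρ_ _).hom ≫ (λ_ _).inv) ≫
        ((α_ F V (𝟙 _)).hom ≫ F ◁ ((ρ_ V).hom ≫ θ) ≫ (α_ _ _ _).inv) ▷ X.str.T =
        A.str.T ◁ ((α_ F V (𝟙 _)).hom ≫ F ◁ ((ρ_ V).hom ≫ θ) ≫ (α_ _ _ _).inv) ≫
          lawComp h X.str.c at hτ
      rw [← cancel_epi (A.str.T ◁ (ρ_ (F ≫ V)).hom)]
      calc _ = lawComp h ((ρ_ _).hom ≫ (λ_ _).inv) ≫
            ((α_ F V (𝟙 _)).hom ≫ F ◁ ((ρ_ V).hom ≫ θ) ≫ (α_ _ _ _).inv) ▷ X.str.T := by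
            simp only [lawComp]; bicategory
        _ = _ := by rw [hτ]; bicategory)
    exact ⟨LaxHom.mk F k (L.isLax_of_lawComp hI.reflects hl), rfl⟩
  · exact cell_ext (hI.faithful (congrArg (fun i => TangentCell.cell (Insert.Hom.cell i)) e))
  · rintro ⟨⟨m, hm⟩, hc⟩
    obtain ⟨ψ, hψ⟩ := ((hI A.obj).bijective_map (LaxHom.hom F) (LaxHom.hom F')).2
      ⟨m, congrArg TangentCell.cell hc⟩
    obtain rfl : ψ ▷ V = m := congrArg Insert.Hom.cell hψ
    exact ⟨TangentCell.mk ψ (L.isCompatible_of_whiskerRight hI.reflects hm), rfl⟩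


/-! ### Strictness, and vector fields from inserters and equifiers in `Tng(K)`. -/

/-- Compatibility of an identity 2-morphism with two laws forces the laws to agree. Applied to
associators, this shows that composition in `Tng(K)` is strictly associative when it is so in `K`.
-/
lemma LaxHom.exists_eqToHom {A B : Tangentad K} {F G : A ⟶ B} (f : F ⟶ G)
    (e : LaxHom.hom F = LaxHom.hom G) (h : TangentCell.cell f = eqToHom e) :
    ∃ e' : F = G, f = eqToHom e' := by
  obtain ⟨F, a, ha⟩ := F
  obtain ⟨G, b, hb⟩ := G
  obtain rfl : F = G := e
  have hf := f.comm
  change a ≫ TangentCell.cell f ▷ B.str.T = A.str.T ◁ TangentCell.cell f ≫ b at hf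
  rw [h] at hf
  simp only [eqToHom_refl, id_whiskerRight, Bicategory.whiskerLeft_id, Category.id_comp,
    Category.comp_id] at hf
  subst hf
  exact ⟨rfl, cell_ext h⟩

lemma Tangentad.exists_associator_eqToHom [Bicategory.Strict K] {A B C D : Tangentad K}
    (F : A ⟶ B) (G : B ⟶ C) (H : C ⟶ D) :
    ∃ e : (F ≫ G) ≫ H = F ≫ G ≫ H, (α_ F G H).hom = eqToHom e :=
  LaxHom.exists_eqToHom _ (Bicategory.Strict.assoc _ _ _)
    (congrArg CategoryTheory.Iso.hom (Bicategory.Strict.associator_eqToIso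
      (LaxHom.hom F) (LaxHom.hom G) (LaxHom.hom H)))

lemma LaxHom.IsStrict.comp [Bicategory.Strict K] {A B C : Tangentad K} {F : LaxHom A B}
    {G : LaxHom B C} (hF : F.IsStrict) (hG : G.IsStrict) : (F.comp G).IsStrict := by
  obtain ⟨e, he⟩ := hF
  obtain ⟨e', he'⟩ := hG
  refine ⟨by rw [LaxHom.comp_hom, ← Bicategory.Strict.assoc, e, Bicategory.Strict.assoc, e',
    Bicategory.Strict.assoc], ?_⟩
  simp [lawComp, he, he', Bicategory.Strict.associator_eqToIso]
  rfl

lemma LaxHom.IsStrict.isIso_law {A B : Tangentad K} {F : LaxHom A B} (hF : F.IsStrict) :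
    IsIso F.law := by
  obtain ⟨e, he⟩ := hF
  rw [he]
  infer_instance

namespace VectorField

lemma ext_of_eqToHom {A X : Tangentad K} {u u' : VectorField A X} (e : u.hom = u'.hom)
    (h : u.field ≫ eqToHom e ▷ tangentHom X = eqToHom e ≫ u'.field) : u = u' := by
  obtain ⟨G, u, hu⟩ := u
  obtain ⟨G', u', hu'⟩ := u'
  obtain rfl : G = G' := e
  obtain rfl : u = u' := by simpa using h
  rfl

lemma eqToHom_comm {A X : Tangentad K} {u u' : VectorField A X} (h : u = u') :
    u.field ≫ eqToHom (congrArg hom h) ▷ tangentHom X =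
      eqToHom (congrArg hom h) ≫ u'.field := by
  subst h
  simp

lemma isIso_of_isIso_cell {A X : Tangentad K} {u u' : VectorField A X} (φ : u ⟶ u')
    (h : IsIso φ.cell) : IsIso φ := by
  refine ⟨⟨inv φ.cell, ?_⟩, Hom.ext (IsIso.hom_inv_id φ.cell), Hom.ext (IsIso.inv_hom_id φ.cell)⟩
  rw [← cancel_epi φ.cell, ← reassoc_of% φ.comm, ← comp_whiskerRight]
  simp

/-- The components are whiskerings of the law of `u.hom`; inverses are automatically tangent
2-morphisms and morphisms of vector fields. -/
lemma isIso_Γlaw {B X : Tangentad K} (u : VectorField B X) (h : IsIso (LaxHom.law u.hom))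
    (A : Tangentad K) : IsIso (u.Γlaw A) := by
  have : IsIso (lawCell u.hom) :=
    (LaxHom.isoMk (F := (tangentHom B).comp u.hom) (G := LaxHom.comp u.hom (tangentHom X))
      (@asIso _ _ _ _ (LaxHom.law u.hom) h) (TangentCell.comm (lawCell u.hom))).isIso_hom
  have (H : A ⟶ B) : IsIso ((u.Γlaw A).app H) := by
    refine isIso_of_isIso_cell _ ?_
    change IsIso ((α_ _ _ _).hom ≫ H ◁ lawCell u.hom ≫ (α_ _ _ _).inv)
    infer_instance
  exact NatIso.isIso_of_isIso_app _

end VectorField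

section

variable {B : Type u} [Bicategory.{w, v} B] {X I E A : B} {T : X ⟶ X} {V : I ⟶ X}

/-- Identifies the equifier condition on `L` with the section condition on the coalgebra that `L`
classifies. -/
lemma whiskerLeft_projected_eq (p : T ⟶ 𝟙 X) (θ : V ⟶ V ≫ T) (L : A ⟶ I) :
    L ◁ projected p ((ρ_ V).hom ≫ θ) =
      (L ◁ θ ≫ (α_ _ _ _).inv) ≫ (L ≫ V) ◁ p ≫ (ρ_ _).hom := by
  simp only [projected]
  bicategory

/-- The inserter sees `(M ≫ W) ≫ V` whereas `Γ` produces `M ≫ (W ≫ V)`; the two fields correspond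
under the associator. -/
lemma associator_field (θ : V ⟶ V ≫ T) (W : E ⟶ I) (M : A ⟶ E) :
    ((M ≫ W) ◁ θ ≫ (α_ _ _ _).inv) ≫ (α_ M W V).hom ▷ T =
      (α_ M W V).hom ≫ M ◁ (W ◁ θ ≫ (α_ W V T).inv) ≫ (α_ _ _ _).inv := by
  bicategory

lemma associator_field_comm {θ : V ⟶ V ≫ T} {W : E ⟶ I} {M M' : A ⟶ E}
    {m : M ≫ W ≫ V ⟶ M' ≫ W ≫ V}
    (h : (M ◁ (W ◁ θ ≫ (α_ W V T).inv) ≫ (α_ _ _ _).inv) ≫ m ▷ T =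
      m ≫ M' ◁ (W ◁ θ ≫ (α_ W V T).inv) ≫ (α_ _ _ _).inv) :
    ((M ≫ W) ◁ θ ≫ (α_ _ _ _).inv) ≫ ((α_ M W V).hom ≫ m ≫ (α_ M' W V).inv) ▷ T =
      ((α_ M W V).hom ≫ m ≫ (α_ M' W V).inv) ≫ (M' ≫ W) ◁ θ ≫ (α_ _ _ _).inv := by
  calc _ = (α_ _ _ _).hom ≫ ((M ◁ (W ◁ θ ≫ (α_ W V T).inv) ≫ (α_ _ _ _).inv) ≫ m ▷ T) ≫
        (α_ _ _ _).inv ▷ T := by bicategory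
    _ = _ := by rw [h]; bicategory

end

variable {X I E : Tangentad K} {V : I ⟶ X} {θ : V ⟶ V ≫ tangentHom X} {W : E ⟶ I}

/-- The vector field on an equifier of an inserter. -/
def universalField (hW : W ◁ projected (projCell X) ((ρ_ V).hom ≫ θ) = W ◁ 𝟙 V) :
    VectorField E X where
  hom := W ≫ V
  field := W ◁ θ ≫ (α_ W V (tangentHom X)).inv
  isSection := by
    rw [← whiskerLeft_projected_eq, hW, Bicategory.whiskerLeft_id]

/-- Up to the associator, `Γ_v` is postcomposition with `W` followed by the functor of the inserter.
The inserter classifies the coalgebra `(G, u)`, and the equifier selects the coalgebras that are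
sections of `p`. -/
theorem isIsoOfCategories_Γ [Bicategory.Strict K]
    (hI : IsInserter (𝟙 X) (tangentHom X) V ((ρ_ V).hom ≫ θ))
    (hE : IsEquifier (projected (projCell X) ((ρ_ V).hom ≫ θ)) (𝟙 V) W) (A : Tangentad K) :
    IsIsoOfCategories ((universalField hE.choose).Γ A) := by
  refine isIsoOfCategories_of_bijective _ ⟨fun M M' h => hE.hom_ext ?_, ?_⟩ fun M M' => ⟨?_, ?_⟩
  · obtain ⟨e₁, he₁⟩ := Tangentad.exists_associator_eqToHom M W V
    obtain ⟨e₂, he₂⟩ := Tangentad.exists_associator_eqToHom M' W V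
    have h₁ := VectorField.eqToHom_comm h
    have e₀ : M ≫ W ≫ V = M' ≫ W ≫ V := congrArg VectorField.hom h
    change (M ◁ (W ◁ θ ≫ (α_ W V (tangentHom X)).inv) ≫ (α_ _ _ _).inv) ≫
      eqToHom e₀ ▷ tangentHom X = eqToHom e₀ ≫ M' ◁ (W ◁ θ ≫ (α_ W V (tangentHom X)).inv) ≫
        (α_ _ _ _).inv at h₁
    refine hI.hom_ext (e₁.trans (e₀.trans e₂.symm)) ?_
    have e₃ : eqToHom (e₁.trans (e₀.trans e₂.symm)) =
        (α_ M W V).hom ≫ eqToHom e₀ ≫ (α_ M' W V).inv := by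
      rw [← cancel_mono (α_ M' W V).hom, he₁, Category.assoc, Category.assoc, Iso.inv_hom_id,
        he₂]
      simp
    rw [e₃]
    exact associator_field_comm h₁
  · rintro ⟨G, u, hu⟩
    obtain ⟨L, e, h⟩ := hI.exists_hom G u
    subst e
    obtain rfl : u = L ◁ θ ≫ (α_ _ _ _).inv := by simpa using h
    obtain ⟨M, rfl⟩ := hE.exists_hom L (by
      rw [whiskerLeft_projected_eq, hu, Bicategory.whiskerLeft_id])
    obtain ⟨e, he⟩ := Tangentad.exists_associator_eqToHom M W V
    refine ⟨M, (VectorField.ext_of_eqToHom e ?_).symm⟩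
    change ((M ≫ W) ◁ θ ≫ (α_ _ _ _).inv) ≫ eqToHom e ▷ tangentHom X =
      eqToHom e ≫ M ◁ (W ◁ θ ≫ (α_ W V (tangentHom X)).inv) ≫ (α_ _ _ _).inv
    rw [← he]
    exact associator_field θ W M
  · intro f g h
    refine (hE.bijective_cell M M').1 (hI.faithful ?_)
    have h : f ▷ (W ≫ V) = g ▷ (W ≫ V) := congrArg VectorField.Hom.cell h
    rw [whiskerRight_comp, whiskerRight_comp] at h
    simpa using h
  · rintro ⟨m, hm⟩
    change M ≫ W ≫ V ⟶ M' ≫ W ≫ V at m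
    replace hm : (M ◁ (W ◁ θ ≫ (α_ W V (tangentHom X)).inv) ≫ (α_ _ _ _).inv) ≫
      m ▷ tangentHom X = m ≫ M' ◁ (W ◁ θ ≫ (α_ W V (tangentHom X)).inv) ≫
        (α_ _ _ _).inv := hm
    obtain ⟨n, hn⟩ := hI.exists_cell (H := M ≫ W) (H' := M' ≫ W)
      ((α_ M W V).hom ≫ m ≫ (α_ M' W V).inv) (associator_field_comm hm)
    obtain ⟨k, hk⟩ := (hE.bijective_cell M M').2 n
    have hk : k ▷ W = n := hk
    refine ⟨k, VectorField.Hom.ext ?_⟩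
    change k ▷ (W ≫ V) = m
    rw [whiskerRight_comp, hk, hn]
    simp

theorem isUniversal_universalField [Bicategory.Strict K]
    (hI : IsInserter (𝟙 X) (tangentHom X) V ((ρ_ V).hom ≫ θ))
    (hE : IsEquifier (projected (projCell X) ((ρ_ V).hom ≫ θ)) (𝟙 V) W)
    (hV : LaxHom.IsStrict V) (hW : LaxHom.IsStrict W) :
    (universalField hE.choose).IsUniversal :=
  ⟨hW.comp hV, fun A => ⟨isIsoOfCategories_Γ hI hE A,
    VectorField.isIso_Γlaw _ (hW.comp hV).isIso_law A⟩⟩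

/-- Along `a`, the whiskering of `p_V · θ` with `S` is conjugate to `A (p_V · θ)`, which becomes an
identity after precomposition with `W`. Hence `S ∘ W` factors through the equifier. -/
lemma IsCoalgSq.whiskerLeft_comp_projected {X I E : K} {T : X ⟶ X} {V : I ⟶ X} {θ : V ⟶ V ≫ T}
    {p : T ⟶ 𝟙 X} {W : E ⟶ I} {S : I ⟶ I} {A : X ⟶ X} {a : S ≫ V ≅ V ≫ A} {d : T ≫ A ⟶ A ≫ T}
    (h : IsCoalgSq θ a.hom d) (hd : d ≫ A ◁ p = p ▷ A ≫ (λ_ _).hom ≫ (ρ_ _).inv)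
    (hW : W ◁ projected p ((ρ_ V).hom ≫ θ) = W ◁ 𝟙 V) :
    (W ≫ S) ◁ projected p ((ρ_ V).hom ≫ θ) = (W ≫ S) ◁ 𝟙 V := by
  have e : S ◁ projected p ((ρ_ V).hom ≫ θ) =
      a.hom ≫ projected p ((ρ_ V).hom ≫ θ) ▷ A ≫ a.inv := by
    rw [← Category.assoc, Iso.eq_comp_inv, h.whiskerLeft_projected hd]
  rw [comp_whiskerLeft, e]
  calc _ = 𝟙 _ ⊗≫ W ◁ a.hom ⊗≫ (W ◁ projected p ((ρ_ V).hom ≫ θ)) ▷ A ⊗≫ W ◁ a.inv ⊗≫ 𝟙 _ := by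
        bicategory
    _ = 𝟙 _ ⊗≫ W ◁ (a.hom ≫ a.inv) ⊗≫ 𝟙 _ := by rw [hW]; bicategory
    _ = _ := by rw [a.hom_inv_id]; bicategory

end

end Tng

/-! ### The main theorem. -/

open Tng
theorem mainTheorem2 (K : Type u) [Bicategory.{w, v} K] [Bicategory.Strict K] :
    (∀ (X : Tangentad K)
        (I : K) (V : I ⟶ X.obj) (θ : V ≫ 𝟙 X.obj ⟶ V ≫ X.str.T)
        (_ : IsInserter (𝟙 X.obj) X.str.T V θ)
        (E : K) (W : E ⟶ I) (_ : IsEquifier (projected X.str.p θ) (𝟙 V) W),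
      AdmitsVectorFields X ∧
      ∃ (tI : TangentStructure I) (tE : TangentStructure E)
        (αV : tI.T ≫ V ⟶ V ≫ X.str.T) (hV : IsLax ⟨I, tI⟩ X V αV)
        (αW : tE.T ≫ W ⟶ W ≫ tI.T) (hW : IsLax ⟨E, tE⟩ ⟨I, tI⟩ W αW),
        let V' : (⟨I, tI⟩ : Tangentad K) ⟶ X := LaxHom.mk V αV hV
        let W' : (⟨E, tE⟩ : Tangentad K) ⟶ (⟨I, tI⟩ : Tangentad K) := LaxHom.mk W αW hW
        LaxHom.IsStrict V' ∧ LaxHom.IsStrict W' ∧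
        ∃ hθ : IsCompatible (V' ≫ 𝟙 X) (V' ≫ tangentHom X) θ,
          let θ' : V' ≫ 𝟙 X ⟶ V' ≫ tangentHom X := TangentCell.mk θ hθ
          IsInserter (𝟙 X) (tangentHom X) V' θ' ∧
          IsEquifier (projected (projCell X) θ') (𝟙 V') W' ∧
          ∃ hv, VectorField.IsUniversal
            (VectorField.mk (W' ≫ V') (W' ◁ ((ρ_ V').inv ≫ θ') ≫ (α_ W' V' (tangentHom X)).inv)
              hv)) ∧
    (HasInserters K → HasEquifiers K → ∀ X : Tangentad K, AdmitsVectorFields X) := by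
  refine (and_iff_left_of_imp fun h hi he X => ?_).2 ?_
  · obtain ⟨I, V, θ, hI⟩ := hi _ _ (𝟙 X.obj) X.str.T
    obtain ⟨E, W, hE⟩ := he _ _ _ _ (projected X.str.p θ) (𝟙 V)
    exact (h X I V θ hI E W hE).1
  · intro X I V θ' hI E W hE
    obtain ⟨θ, rfl⟩ : ∃ θ, θ' = (ρ_ V).hom ≫ θ := ⟨(ρ_ V).inv ≫ θ', by simp⟩
    obtain ⟨L, hLs, hL, hLn⟩ := hI.exists_tangentLift
    -- `T` restricts to `E` because `p_T · c = T p`, and `T_n` because of the analogous identity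
    -- `hdp`.
    obtain ⟨M, hM⟩ := IsEquifier.exists_tangentLift (A := L.tangentad hI.reflects) hE
      (hL.whiskerLeft_comp_projected X.str.flip_comp_p hE.choose) (fun n => by
        obtain ⟨d, hd, hdp⟩ := hLn n
        exact hd.whiskerLeft_comp_projected hdp hE.choose)
    have hI' := hI.tangentad hL
    let V' := L.hom hI.reflects
    let θ' : V' ≫ 𝟙 X ⟶ V' ≫ tangentHom X :=
      TangentCell.mk ((ρ_ V).hom ≫ θ) (isCompatible_of_isCoalgSq hI.reflects hL)
    let W' := M.hom (hE.reflects _)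
    -- The 2-morphism underlying `projected (projCell X) θ'` is definitionally the one that `hE`
    -- equifies in `K`.
    have hE' : IsEquifier (projected (projCell X) θ') (𝟙 V') W' :=
      IsEquifier.tangentad (φ := projected (projCell X) θ') (ψ := 𝟙 V') hE M
    have hθ : θ' = (ρ_ V').hom ≫ (ρ_ V').inv ≫ θ' := by simp
    have hI'' : IsInserter (𝟙 X) (tangentHom X) V' ((ρ_ V').hom ≫ (ρ_ V').inv ≫ θ') := by
      rw [← hθ]; exact hI'
    have hE'' : IsEquifier (projected (projCell X) ((ρ_ V').hom ≫ (ρ_ V').inv ≫ θ')) (𝟙 V') W' := by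
      rw [← hθ]; exact hE'
    have huniv := isUniversal_universalField hI'' hE'' hLs hM
    exact ⟨⟨_, _, huniv⟩, L.tangentStructure hI.reflects, M.tangentStructure (hE.reflects _),
      L.law.hom, L.isLax hI.reflects, M.law.hom, M.isLax (hE.reflects _), hLs, hM,
      isCompatible_of_isCoalgSq hI.reflects hL, hI', hE', _, huniv⟩
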